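/- Notation. Write $H_b(t)=-t\log_2 t-(1-t)\log_2(1-t)$ (with $0\log_2 0=0$) and $s*t=s(1-t)+(1-s)t$. Let $0\le p\le\frac12$ and let $(X,Y)$ be a DSBS$(p)$: $\Pr(X=Y=0)=\Pr(X=Y=1)=\frac{1-p}{2}$ and $\Pr(X=0,Y=1)=\Pr(X=1,Y=0)=\frac p2$. Let $(X^n,Y^n)$ be $n$ i.i.d. copies, $Z^n=X^n+Y^n$ over $\mathbb F_2$, and let $d$ be the per-letter Hamming distortion. Below $2^{n(R+\epsilon)}$ stands for its integer part. LKM. A triple $(R_1,R_2,D)$ is LKM-achievable if for every $\epsilon>0$ and all sufficiently large $n$ there are $E_i:\mathbb F_2^n\to[2^{n(R_i+\epsilon)}]$, $i=1,2$, and a decoder $\mathcal D$ with values in $\mathbb F_2^n$ such that $\mathbb E\,d\big(Z^n,\mathcal D(E_1(X^n),E_2(Y^n))\big)\le D$. CSR. It is CSR-achievable if for every $\epsilon>0$ and all sufficiently large $n$ there are $E_i:\mathbb F_2^n\to[2^{n(R_i+\epsilon)}]$ and decoders $\mathcal D_1,\mathcal D_2$ such that $\hat Z_1=\mathcal D_1(X^n,E_2(Y^n))$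 and $\hat Z_2=\mathcal D_2(Y^n,E_1(X^n))$ satisfy $\mathbb E\,d(Z^n,\hat Z_1)\le D$, $\mathbb E\,d(Z^n,\hat Z_2)\le D$ and $\Pr(\hat Z_1\ne\hat Z_2)\le\epsilon$. Linear scheme. For $U\in\mathbb F_2^{m\times n}$ and $V\in\mathbb F_2^{r\times n}$ let $Q(x)$ be a word of $\{z: Uz=0\}$ closest to $x$ in Hamming distance, $f(x)=VQ(x)$, and let $g(a,b,s)$ be a word $z$ of minimum Hamming weight with $Uz=s$ and $Vz=a+b$. With dither words $d_X,d_Y\in\mathbb F_2^n$, the encoders send $f(X^n+d_X)$ and $f(Y^n+d_Y)$, and on receiving $a,b$ the decoder outputs $g(a+Vd_X,\,b+Vd_Y,\,U(d_X+d_Y))$. The linear scheme achieves $(R_1,R_2,D)$ if for every $\epsilon>0$ and all sufficiently large $n$ there are $m,r,U,V$ with $2^r\le 2^{n(R_1+\epsilon)}$ and $2^r\le 2^{n(R_2+\epsilon)}$ for which the expected distortion is at most $D$ when $d_X,d_Y$ are independent, uniform on $\mathbb F_2^n$ and independent of $(X^n,Y^n)$, and for which moreover some fixed pair $(d_X,d_Y)$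 has expected distortion at most $D$. Statement. Let $$\mathcal R_C=\{(R_1,R_2,D): \exists\, q\in[0,\tfrac12],\ R_1,R_2\ge H_b(p*q*q)-H_b(q),\ D\ge q*q\},$$ $$\mathcal R_B=\{(R_1,R_2,D): R_1\ge0,\ R_2\ge0,\ D\ge p\}.$$ Call a triple exceptional if $D=0$, $p>0$ and $\min(R_1,R_2)<1$. (1) Every non-exceptional triple in $\mathcal R_C$ is achieved by the linear scheme and is LKM-achievable. If $(R_1,R_2,0)\in\mathcal R_C$, then for every $\delta>0$ the triple $(R_1,R_2,\delta)$ is achieved by the linear scheme and is LKM-achievable. (2) Every non-exceptional triple in $\mathrm{conv}(\mathcal R_C\cup\mathcal R_B)$ is CSR-achievable. If $(R_1,R_2,0)\in\mathrm{conv}(\mathcal R_C\cup\mathcal R_B)$, then $(R_1,R_2,\delta)$ is CSR-achievable for every $\delta>0$. -/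

import Mathlib

noncomputable section

namespace CSR

/-- Binary words of length `n`, i.e. vectors over the field with two elements. -/
abbrev Word (n : ℕ) : Type := Fin n → ZMod 2

/-- The binary entropy function, in bits. -/
def Hb (p : ℝ) : ℝ := -p * Real.logb 2 p - (1 - p) * Real.logb 2 (1 - p)

/-- Binary convolution `p * q = p (1 - q) + (1 - p) q`. -/
def bconv (p q : ℝ) : ℝ := p * (1 - q) + (1 - p) * q

/-- The joint law of `(X, Y)` for a doubly symmetric binary source with parameter `p`. -/
def dsbs (p : ℝ) (x y : ZMod 2) : ℝ := if x = y then (1 - p) / 2 else p / 2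

/-- The joint law of `(X^n, Y^n)`: `n` independent copies of a DSBS(`p`) pair. -/
def dsbsLaw (p : ℝ) {n : ℕ} (x y : Word n) : ℝ := ∏ i, dsbs p (x i) (y i)

/-- Expectation of `F (X^n, Y^n)` for `n` independent copies of a DSBS(`p`) pair. -/
def expect (p : ℝ) {n : ℕ} (F : Word n → Word n → ℝ) : ℝ :=
  ∑ x, ∑ y, dsbsLaw p x y * F x y

open Classical in
/-- Probability of the event `A (X^n, Y^n)`. -/
def prob (p : ℝ) {n : ℕ} (A : Word n → Word n → Prop) : ℝ :=
  expect p (fun x y => if A x y then 1 else 0)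

/-- Hamming distortion of two words of length `n`, per letter. -/
def distortion {n : ℕ} (z w : Word n) : ℝ := (hammingDist z w : ℝ) / n

/-- The number of messages `2^{nR}` (integer part) at block length `n` and rate `R`. -/
def numMessages (n : ℕ) (R : ℝ) : ℕ := ⌊(2 : ℝ) ^ ((n : ℝ) * R)⌋₊

/-! ### The lossy Körner–Marton problem -/

/-- Expected distortion between `Z^n = X^n + Y^n` and `dec (enc₁ X^n) (enc₂ Y^n)`. -/
def lkmDistortion (p : ℝ) {n : ℕ} {M₁ M₂ : Type} (enc₁ : Word n → M₁) (enc₂ : Word n → M₂)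
    (dec : M₁ → M₂ → Word n) : ℝ :=
  expect p (fun x y => distortion (x + y) (dec (enc₁ x) (enc₂ y)))

/-- An `(n, N₁, N₂, D)`-LKM coding scheme for a DSBS(`p`). -/
structure LKMScheme (p : ℝ) (n N₁ N₂ : ℕ) (D : ℝ) where
  enc₁ : Word n → Fin N₁
  enc₂ : Word n → Fin N₂
  dec : Fin N₁ → Fin N₂ → Word n
  distortion_le : lkmDistortion p enc₁ enc₂ dec ≤ D

/-- The set of LKM-achievable triples `(R₁, R₂, D)`. -/
def regionLKM (p : ℝ) : Set (ℝ × ℝ × ℝ) :=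
  {T | ∀ ε : ℝ, 0 < ε → ∃ n₀ : ℕ, ∀ n : ℕ, n₀ ≤ n →
    Nonempty (LKMScheme p n (numMessages n (T.1 + ε)) (numMessages n (T.2.1 + ε)) T.2.2)}

/-! ### The common sum reconstruction problem -/

/-- An `(n, N₁, N₂, D, ε)`-CSR coding scheme for a DSBS(`p`). -/
structure CSRScheme (p : ℝ) (n N₁ N₂ : ℕ) (D ε : ℝ) where
  enc₁ : Word n → Fin N₁
  enc₂ : Word n → Fin N₂
  dec₁ : Word n → Fin N₂ → Word n
  dec₂ : Word n → Fin N₁ → Word n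
  distortion₁_le : expect p (fun x y => distortion (x + y) (dec₁ x (enc₂ y))) ≤ D
  distortion₂_le : expect p (fun x y => distortion (x + y) (dec₂ y (enc₁ x))) ≤ D
  disagree_le : prob p (fun x y => dec₁ x (enc₂ y) ≠ dec₂ y (enc₁ x)) ≤ ε

/-- The set of CSR-achievable triples `(R₁, R₂, D)`. -/
def regionCSR (p : ℝ) : Set (ℝ × ℝ × ℝ) :=
  {T | ∀ ε : ℝ, 0 < ε → ∃ n₀ : ℕ, ∀ n : ℕ, n₀ ≤ n →
    Nonempty (CSRScheme p n (numMessages n (T.1 + ε)) (numMessages n (T.2.1 + ε)) T.2.2 ε)}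

/-! ### The linear scheme given by the matrices `U` and `V` -/

/-- The quantizer: a closest word to `x` in the linear code with parity-check matrix `U`. -/
def quantize {m n : ℕ} (U : Matrix (Fin m) (Fin n) (ZMod 2)) (x : Word n) : Word n :=
  Function.argminOn (fun z : Word n => hammingNorm (x + z)) {z : Word n | U.mulVec z = 0}
    ⟨0, U.mulVec_zero⟩

/-- The map `f`: quantize, then take the syndrome with respect to `V`. -/
def syndromeEnc {m r n : ℕ} (U : Matrix (Fin m) (Fin n) (ZMod 2))
    (V : Matrix (Fin r) (Fin n) (ZMod 2)) (x : Word n) : Word r :=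
  V.mulVec (quantize U x)

open Classical in
/-- The map `g`: a word `z` of minimum weight among those with `U z = s` and `V z = a + b`
(the zero word if there are none). -/
def minWeightDec {m r n : ℕ} (U : Matrix (Fin m) (Fin n) (ZMod 2))
    (V : Matrix (Fin r) (Fin n) (ZMod 2)) (a b : Word r) (s : Word m) : Word n :=
  if h : {z : Word n | U.mulVec z = s ∧ V.mulVec z = a + b}.Nonempty then
    Function.argminOn (fun z : Word n => hammingNorm z)
      {z : Word n | U.mulVec z = s ∧ V.mulVec z = a + b} h
  else 0

/-- Expected distortion of the scheme `(U, V)` with dither words `dX` and `dY`: the encoders send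
`f (X^n + dX)` and `f (Y^n + dY)`; the decoder, which knows the dither, adds `V dX` and `V dY` to
the received words and applies `g` with `s = U (dX + dY)`. -/
def ditheredDistortion (p : ℝ) {m r n : ℕ} (U : Matrix (Fin m) (Fin n) (ZMod 2))
    (V : Matrix (Fin r) (Fin n) (ZMod 2)) (dX dY : Word n) : ℝ :=
  lkmDistortion p (fun x => syndromeEnc U V (x + dX)) (fun y => syndromeEnc U V (y + dY))
    (fun a b => minWeightDec U V (a + V.mulVec dX) (b + V.mulVec dY) (U.mulVec (dX + dY)))

/-- The triple `(R₁, R₂, D)` is achieved by the linear scheme: for every `ε > 0` and all large `n`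
there are matrices `U` and `V` whose syndromes fit into the two message sets, such that the expected
distortion is at most `D` when the two dither words are independent and uniform, and also for some
fixed pair of dither words. -/
def LinearSchemeAchieves (p R₁ R₂ D : ℝ) : Prop :=
  ∀ ε : ℝ, 0 < ε → ∃ n₀ : ℕ, ∀ n : ℕ, n₀ ≤ n →
    ∃ (m r : ℕ) (U : Matrix (Fin m) (Fin n) (ZMod 2)) (V : Matrix (Fin r) (Fin n) (ZMod 2)),
      2 ^ r ≤ numMessages n (R₁ + ε) ∧ 2 ^ r ≤ numMessages n (R₂ + ε) ∧
      (∑ dX : Word n, ∑ dY : Word n,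
        (1 / 2 ^ n : ℝ) * (1 / 2 ^ n : ℝ) * ditheredDistortion p U V dX dY) ≤ D ∧
      ∃ dX dY : Word n, ditheredDistortion p U V dX dY ≤ D

/-! ### The two regions of the inner bound -/

/-- Triples that need no communication: nonnegative rates and distortion at least `p`. -/
def regionB (p : ℝ) : Set (ℝ × ℝ × ℝ) := {T | 0 ≤ T.1 ∧ 0 ≤ T.2.1 ∧ p ≤ T.2.2}

/-- The region `R₁, R₂ ≥ H_b(p * q * q) - H_b(q)`, `D ≥ q * q` for some `0 ≤ q ≤ 1/2`. -/
def regionC (p : ℝ) : Set (ℝ × ℝ × ℝ) :=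
  {T | ∃ q : ℝ, 0 ≤ q ∧ q ≤ 1 / 2 ∧ Hb (bconv (bconv p q) q) - Hb q ≤ T.1 ∧
    Hb (bconv (bconv p q) q) - Hb q ≤ T.2.1 ∧ bconv q q ≤ T.2.2}

end CSR

end

/-! Fix q > 0 and put s = p * q * q. A linear code C of size about 2^(n(1 - H_b(q))), up to a factor
subexponential in the limit, has almost every word within distance about nq
(`exists_covering_code`); U is a parity check of C. After dithering, each encoder quantizes a
uniform word independent of the source. The decoder then knows the U- and V-syndromes of W = Z + E_1
+ E_2, where the E_i are the quantization errors, and outputs a word of least weight with these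
syndromes (`ditheredDistortion_eq`, `average_ditheredDistortion`). If that word is W, the distortion
is the weight of E_1 + E_2 per letter.

The errors are not Bernoulli words, but their laws are nearly dominated by one: at most |C| words
share a given error, so outside the few uncovered words the law of E_i is at most K times the
Bernoulli(q) law, where the exponential growth rate of K can be made as small as desired. Events
that are exponentially unlikely for Bernoulli words stay so after two such changes of measure, at
the price K^2 (`sum_sum_qerr_le`, `mean_qerr_le`). With Chernoff's bound, E_1 + E_2 has weight at
most about n(q * q) and W at most about ns, with high probability.

Decoding fails only if some nonzero c in C has V c = 0 and W + c no heavier than W. A whole sum over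
C does not see the codewords by which the errors differ from uniform words, so the expected number
of c in C with W + c in a ball B is exactly |C||B| / 2^n (`sum_mean_ball`). Binning to r bits leaves
a fraction 2^(-r) of the nonzero ones (`exists_binning`), which vanishes once r/n exceeds H_b(s) -
H_b(q).

A positive D leaves room to move q to a nearby positive value with strict slack. For D = 0 the
nonexceptional triples have p = 0 or both rates at least 1, and sending nothing or everything is
lossless.

For the convex hull, concatenated Körner–Marton schemes give time sharing up to a slack in D
(`convex_slackRegion`); a little time spent on a lossless scheme removes the slack when D > 0. In
the CSR problem each user computes its own message and runs the Körner–Marton decoder, so the two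
reconstructions agree always. -/

open Filter Topology

namespace CSR

/-! ### Exponential tail bounds for independent letters -/

/-- Chernoff's bound for independent letters from a finite alphabet. -/
theorem exists_tail_le_pow {A : Type*} [Fintype A] (μ f : A → ℝ) (hμ : ∀ a, 0 ≤ μ a)
    (hsum : ∑ a, μ a = 1) (t : ℝ) (ht : ∑ a, μ a * f a < t) :
    ∃ ρ : ℝ, 0 < ρ ∧ ρ < 1 ∧ ∀ n : ℕ,
      ∑ e : Fin n → A, (∏ i, μ (e i)) * (if n * t ≤ ∑ i, f (e i) then 1 else 0) ≤ ρ ^ n := by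
  classical
  -- The moment generating function of `f - t`: it is 1 at 0 with negative slope there, so it is
  -- below 1 at some `θ > 0`, and Markov's inequality applies.
  let M : ℝ → ℝ := fun θ => ∑ a, μ a * Real.exp (θ * (f a - t))
  have hM0 : M 0 = 1 := by simp [M, hsum]
  have hd : HasDerivAt M (∑ a, μ a * (f a - t)) 0 := by
    have : ∀ a ∈ (Finset.univ : Finset A),
        HasDerivAt (fun θ : ℝ => μ a * Real.exp (θ * (f a - t))) (μ a * (f a - t)) 0 := by
      intro a _
      have h1 : HasDerivAt (fun θ : ℝ => θ * (f a - t)) (f a - t) 0 := by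
        simpa using (hasDerivAt_id (0 : ℝ)).mul_const (f a - t)
      simpa using (h1.exp).const_mul (μ a)
    have h := HasDerivAt.fun_sum this
    exact h
  have hneg : ∑ a, μ a * (f a - t) < 0 := by
    simp only [mul_sub, Finset.sum_sub_distrib, ← Finset.sum_mul, hsum]
    linarith
  have hev : ∀ᶠ θ in 𝓝[>] (0 : ℝ), M θ < 1 := by
    have h := (hasDerivAt_iff_tendsto_slope.1 hd).mono_left
      (nhdsWithin_mono _ (fun x (hx : 0 < x) => ne_of_gt hx) : 𝓝[>] (0 : ℝ) ≤ 𝓝[≠] 0)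
    filter_upwards [h.eventually (gt_mem_nhds hneg), self_mem_nhdsWithin] with θ h1 h2
    have h3 : (0 : ℝ) < θ := h2
    rw [slope_def_field, hM0, sub_zero, div_lt_iff₀ h3] at h1
    linarith
  obtain ⟨θ, hθ1, hθ0⟩ := (hev.and self_mem_nhdsWithin).exists
  have hθ0 : 0 < θ := hθ0
  refine ⟨M θ, ?_, hθ1, fun n => ?_⟩
  · have hne : ∃ a, 0 < μ a := by
      by_contra! h
      have : ∑ a, μ a ≤ 0 := Finset.sum_nonpos fun a _ => h a
      linarith
    obtain ⟨a, ha⟩ := hne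
    exact Finset.sum_pos' (fun b _ => mul_nonneg (hμ b) (Real.exp_pos _).le)
      ⟨a, Finset.mem_univ a, mul_pos ha (Real.exp_pos _)⟩
  · have hpow : M θ ^ n = ∑ e : Fin n → A, ∏ i, (μ (e i) * Real.exp (θ * (f (e i) - t))) := by
      simp only [M, Fintype.sum_pow]
    rw [hpow]
    refine Finset.sum_le_sum fun e _ => ?_
    rw [Finset.prod_mul_distrib]
    refine mul_le_mul_of_nonneg_left ?_ (Finset.prod_nonneg fun i _ => hμ _)
    rw [← Real.exp_sum]
    split_ifs with h
    · rw [← Finset.mul_sum, Finset.sum_sub_distrib]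
      apply Real.one_le_exp
      refine mul_nonneg hθ0.le ?_
      simp only [Finset.sum_const, Finset.card_univ, Fintype.card_fin, nsmul_eq_mul]
      linarith
    · exact (Real.exp_pos _).le

/-! ### Bernoulli words -/

/-- The law of a bit that is nonzero with probability `q`. -/
noncomputable def bern (q : ℝ) (b : ZMod 2) : ℝ := if b = 0 then 1 - q else q

/-- The law of a word of independent bits that are nonzero with probability `q`. -/
noncomputable def bernWord (q : ℝ) {n : ℕ} (e : Word n) : ℝ := ∏ i, bern q (e i)

theorem sum_zmod_two {M : Type*} [AddCommMonoid M] (f : ZMod 2 → M) : ∑ b, f b = f 0 + f 1 :=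
  Fin.sum_univ_two f

theorem zmod_two_eq (b : ZMod 2) : b = 0 ∨ b = 1 := by
  revert b; decide

theorem bern_nonneg {q : ℝ} (h0 : 0 ≤ q) (h1 : q ≤ 1) (b : ZMod 2) : 0 ≤ bern q b := by
  unfold bern; split_ifs <;> linarith

theorem sum_bern (q : ℝ) : ∑ b, bern q b = 1 := by
  simp [sum_zmod_two, bern]

theorem bernWord_nonneg {q : ℝ} (h0 : 0 ≤ q) (h1 : q ≤ 1) {n : ℕ} (e : Word n) :
    0 ≤ bernWord q e :=
  Finset.prod_nonneg fun _ _ => bern_nonneg h0 h1 _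

theorem sum_bernWord (q : ℝ) (n : ℕ) : ∑ e : Word n, bernWord q e = 1 := by
  have := Fintype.sum_pow (bern q) n
  simpa [sum_bern, bernWord] using this.symm

theorem word_add_self {n : ℕ} (z : Word n) : z + z = 0 :=
  funext fun i => CharTwo.add_self_eq_zero (z i)

theorem word_add_cancel {n : ℕ} (z w : Word n) : z + (z + w) = w := by
  rw [← add_assoc, word_add_self, zero_add]

/-- The sum of two independent Bernoulli words is a Bernoulli word. -/
theorem sum_bernWord_conv (p q : ℝ) {n : ℕ} (F : Word n → ℝ) :
    ∑ z, bernWord p z * ∑ e, bernWord q e * F (z + e) = ∑ w, bernWord (bconv p q) w * F w := by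
  have h1 : ∀ z : Word n, ∑ e, bernWord q e * F (z + e) = ∑ w, bernWord q (w + z) * F w := by
    intro z
    refine Fintype.sum_equiv (Equiv.addLeft z) _ _ fun e => ?_
    have : z + e + z = e := by rw [add_comm, word_add_cancel]
    simp [this]
  have h2 : ∀ w : Word n, bernWord (bconv p q) w = ∑ z, bernWord p z * bernWord q (w + z) := by
    intro w
    simp only [bernWord, ← Finset.prod_mul_distrib, Pi.add_apply]
    have h3 := Finset.prod_univ_sum (fun _ : Fin n => (Finset.univ : Finset (ZMod 2)))
      (fun i b => bern p b * bern q (w i + b))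
    rw [Fintype.piFinset_univ] at h3
    rw [← h3]
    refine Finset.prod_congr rfl fun i _ => ?_
    rw [sum_zmod_two]
    have h11 : (1 : ZMod 2) + 1 = 0 := by decide
    rcases zmod_two_eq (w i) with h | h <;> simp [h, bern, bconv, h11] <;> ring
  simp only [h1, h2, Finset.mul_sum, Finset.sum_mul]
  rw [Finset.sum_comm]
  simp only [mul_assoc]

theorem hammingNorm_eq_sum {n : ℕ} (e : Word n) :
    (hammingNorm e : ℝ) = ∑ i, if e i = 0 then (0 : ℝ) else 1 := by
  simp [hammingNorm, Finset.sum_ite]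

theorem exists_bernWord_tail_le {s t : ℝ} (h0 : 0 ≤ s) (h1 : s ≤ 1) (hst : s < t) :
    ∃ ρ : ℝ, 0 < ρ ∧ ρ < 1 ∧ ∀ n : ℕ,
      ∑ e : Word n, bernWord s e * (if n * t ≤ hammingNorm e then 1 else 0) ≤ ρ ^ n := by
  obtain ⟨ρ, h⟩ := exists_tail_le_pow (bern s) (fun b => if b = 0 then 0 else 1)
    (bern_nonneg h0 h1) (sum_bern s) t (by simpa [sum_zmod_two, bern] using hst)
  refine ⟨ρ, h.1, h.2.1, fun n => ?_⟩
  simpa only [bernWord, hammingNorm_eq_sum] using h.2.2 n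

theorem exists_bernWord_lower_tail_le {s t : ℝ} (h0 : 0 ≤ s) (h1 : s ≤ 1) (hst : t < s) :
    ∃ ρ : ℝ, 0 < ρ ∧ ρ < 1 ∧ ∀ n : ℕ,
      ∑ e : Word n, bernWord s e * (if (hammingNorm e : ℝ) ≤ n * t then 1 else 0) ≤ ρ ^ n := by
  obtain ⟨ρ, h⟩ := exists_tail_le_pow (bern s) (fun b => if b = 0 then 0 else -1)
    (bern_nonneg h0 h1) (sum_bern s) (-t) (by simpa [sum_zmod_two, bern] using hst)
  refine ⟨ρ, h.1, h.2.1, fun n => ?_⟩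
  refine le_of_eq_of_le (Finset.sum_congr rfl fun e _ => ?_) (h.2.2 n)
  have : ∑ i, (if e i = 0 then (0 : ℝ) else -1) = -(hammingNorm e : ℝ) := by
    rw [hammingNorm_eq_sum, ← Finset.sum_neg_distrib]
    exact Finset.sum_congr rfl fun i _ => by split_ifs <;> simp
  simp only [this, mul_neg, neg_le_neg_iff, bernWord]

/-! ### Exponents -/

/-- The normalized self-information, under the Bernoulli law with parameter `q`, of a word whose
fraction of nonzero letters is `a`. -/
noncomputable def ell (q a : ℝ) : ℝ := -(a * Real.logb 2 q) - (1 - a) * Real.logb 2 (1 - q)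

theorem ell_self (q : ℝ) : ell q q = Hb q := by
  unfold ell Hb; ring

theorem ell_sub (q a b : ℝ) :
    ell q a - ell q b = (a - b) * (Real.logb 2 (1 - q) - Real.logb 2 q) := by
  unfold ell; ring

theorem continuous_ell (q : ℝ) : Continuous (ell q) := by
  unfold ell; fun_prop

theorem bernWord_eq {q : ℝ} (h0 : 0 < q) (h1 : q < 1) {n : ℕ} (e : Word n) :
    bernWord q e = (2 : ℝ) ^ (n * Real.logb 2 (1 - q) +
      hammingNorm e * (Real.logb 2 q - Real.logb 2 (1 - q))) := by
  have hb : ∀ b, bern q b = (2 : ℝ) ^ (Real.logb 2 (1 - q) +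
      (if b = 0 then 0 else 1) * (Real.logb 2 q - Real.logb 2 (1 - q))) := by
    intro b
    unfold bern
    split_ifs
    · simp [Real.rpow_logb, show 0 < 1 - q by linarith]
    · simp [Real.rpow_logb, h0]
  simp only [bernWord, hb]
  rw [← Real.rpow_sum_of_pos (by norm_num), Finset.sum_add_distrib, ← Finset.sum_mul,
    ← hammingNorm_eq_sum]
  simp

theorem logb_le_logb_one_sub {q : ℝ} (h0 : 0 < q) (h1 : q ≤ 1 / 2) :
    Real.logb 2 q ≤ Real.logb 2 (1 - q) :=
  Real.logb_le_logb_of_le (by norm_num) h0 (by linarith)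

theorem le_bernWord {q a : ℝ} (h0 : 0 < q) (h1 : q ≤ 1 / 2) {n : ℕ} {e : Word n}
    (he : (hammingNorm e : ℝ) ≤ n * a) : (2 : ℝ) ^ (-(n * ell q a)) ≤ bernWord q e := by
  rw [bernWord_eq h0 (by linarith)]
  refine Real.rpow_le_rpow_of_exponent_le (by norm_num) ?_
  have := mul_le_mul_of_nonneg_right he (sub_nonneg.2 (logb_le_logb_one_sub h0 h1))
  unfold ell
  nlinarith

theorem bernWord_le {q a : ℝ} (h0 : 0 < q) (h1 : q ≤ 1 / 2) {n : ℕ} {e : Word n}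
    (he : n * a ≤ (hammingNorm e : ℝ)) : bernWord q e ≤ (2 : ℝ) ^ (-(n * ell q a)) := by
  rw [bernWord_eq h0 (by linarith)]
  refine Real.rpow_le_rpow_of_exponent_le (by norm_num) ?_
  have := mul_le_mul_of_nonneg_right he (sub_nonneg.2 (logb_le_logb_one_sub h0 h1))
  unfold ell
  nlinarith

open Classical in
/-- The words of length `n` and weight at most `n * a`. -/
noncomputable def ball (n : ℕ) (a : ℝ) : Finset (Word n) := {e | (hammingNorm e : ℝ) ≤ n * a}

theorem mem_ball {n : ℕ} {a : ℝ} {e : Word n} : e ∈ ball n a ↔ (hammingNorm e : ℝ) ≤ n * a := by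
  simp [ball]

/-- Each word of the ball has Bernoulli mass at least `2 ^ (-(n * ell s a))`, and the total mass is
1. -/
theorem card_ball_le {s : ℝ} (h0 : 0 < s) (h1 : s ≤ 1 / 2) (n : ℕ) (a : ℝ) :
    ((ball n a).card : ℝ) ≤ (2 : ℝ) ^ (n * ell s a) := by
  have h : (ball n a).card * (2 : ℝ) ^ (-(n * ell s a)) ≤ 1 := by
    rw [← sum_bernWord s n, ← nsmul_eq_mul]
    refine (Finset.card_nsmul_le_sum _ _ _ fun e he => le_bernWord h0 h1 (mem_ball.1 he)).trans ?_
    exact Finset.sum_le_sum_of_subset_of_nonneg (Finset.subset_univ _)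
      fun e _ _ => bernWord_nonneg h0.le (by linarith) e
  rwa [Real.rpow_neg (by norm_num), ← div_eq_mul_inv, div_le_one (by positivity)] at h

/-- By the two tail bounds, weights between `n * q₂` and `n * q₁` carry at least half of the
Bernoulli mass, and each such word has mass at most `2 ^ (-(n * ell q q₂))`. -/
theorem le_card_ball {q q₁ q₂ : ℝ} (h0 : 0 < q) (h1 : q ≤ 1 / 2) (hq₁ : q < q₁) (hq₂ : q₂ < q) :
    ∀ᶠ n : ℕ in atTop, (1 / 2 : ℝ) * (2 : ℝ) ^ (n * ell q q₂) ≤ (ball n q₁).card := by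
  obtain ⟨ρ, hρ0, hρ1, hρ⟩ := exists_bernWord_tail_le h0.le (by linarith) hq₁
  obtain ⟨σ, hσ0, hσ1, hσ⟩ := exists_bernWord_lower_tail_le h0.le (by linarith) hq₂
  have e1 := (tendsto_pow_atTop_nhds_zero_of_lt_one hρ0.le hρ1).eventually
    (gt_mem_nhds (show (0 : ℝ) < 1 / 4 by norm_num))
  have e2 := (tendsto_pow_atTop_nhds_zero_of_lt_one hσ0.le hσ1).eventually
    (gt_mem_nhds (show (0 : ℝ) < 1 / 4 by norm_num))
  filter_upwards [e1, e2] with n hn1 hn2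
  have key : (1 : ℝ) ≤ ρ ^ n + σ ^ n + (ball n q₁).card * (2 : ℝ) ^ (-(n * ell q q₂)) := by
    have hle : ∀ e : Word n, bernWord q e ≤
        bernWord q e * (if n * q₁ ≤ (hammingNorm e : ℝ) then 1 else 0) +
        bernWord q e * (if (hammingNorm e : ℝ) ≤ n * q₂ then 1 else 0) +
        (if e ∈ ball n q₁ then (2 : ℝ) ^ (-(n * ell q q₂)) else 0) := by
      intro e
      have hb := bernWord_nonneg h0.le (by linarith) e
      have h2 : (0 : ℝ) < (2 : ℝ) ^ (-(n * ell q q₂)) := by positivity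
      by_cases hA : n * q₁ ≤ (hammingNorm e : ℝ)
      · rw [if_pos hA]
        have : 0 ≤ bernWord q e * (if (hammingNorm e : ℝ) ≤ n * q₂ then 1 else 0) :=
          mul_nonneg hb (by split_ifs <;> norm_num)
        have : 0 ≤ (if e ∈ ball n q₁ then (2 : ℝ) ^ (-(n * ell q q₂)) else 0) := by
          split_ifs <;> linarith
        linarith
      · by_cases hB : (hammingNorm e : ℝ) ≤ n * q₂
        · rw [if_neg hA, if_pos hB]
          have : 0 ≤ (if e ∈ ball n q₁ then (2 : ℝ) ^ (-(n * ell q q₂)) else 0) := by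
            split_ifs <;> linarith
          linarith
        · rw [if_neg hA, if_neg hB, if_pos (mem_ball.2 (not_le.1 hA).le)]
          linarith [bernWord_le h0 h1 (not_le.1 hB).le]
    have := Finset.sum_le_sum fun (e : Word n) (_ : e ∈ Finset.univ) => hle e
    rw [sum_bernWord, Finset.sum_add_distrib, Finset.sum_add_distrib] at this
    have h3 : ∑ e : Word n, (if e ∈ ball n q₁ then (2 : ℝ) ^ (-(n * ell q q₂)) else 0) =
        (ball n q₁).card * (2 : ℝ) ^ (-(n * ell q q₂)) := by
      simp [Finset.sum_ite_mem]
    linarith [hρ n, hσ n]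
  have h4 : (1 / 2 : ℝ) ≤ (ball n q₁).card * (2 : ℝ) ^ (-(n * ell q q₂)) := by linarith
  rwa [Real.rpow_neg (by norm_num), ← div_eq_mul_inv, le_div_iff₀ (by positivity)] at h4

/-! ### Linear codes that cover almost everything -/

open Classical in
/-- The words that are at no difference in `T` from the code `C`. -/
noncomputable def uncovered {n : ℕ} (T : Finset (Word n)) (C : Submodule (ZMod 2) (Word n)) :
    Finset (Word n) := {x | ∀ c ∈ C, x + c ∉ T}

theorem mem_uncovered {n : ℕ} {T : Finset (Word n)} {C : Submodule (ZMod 2) (Word n)}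
    {x : Word n} : x ∈ uncovered T C ↔ ∀ c ∈ C, x + c ∉ T := by
  simp [uncovered]

theorem card_word (n : ℕ) : Fintype.card (Word n) = 2 ^ n := by
  simp [ZMod.card]

-- Averaging: over a uniform shift `z`, the mean size of the intersection is `|S| ^ 2 / 2 ^ n`.
open Classical in
theorem exists_card_shift_le {n : ℕ} (S : Finset (Word n)) :
    ∃ z : Word n, (({x ∈ S | x + z ∈ S} : Finset (Word n)).card : ℝ) * 2 ^ n ≤
      (S.card : ℝ) ^ 2 := by
  by_contra! h
  have h1 : ∑ z : Word n, (({x ∈ S | x + z ∈ S} : Finset (Word n)).card : ℝ) =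
      (S.card : ℝ) ^ 2 := by
    have : ∀ z : Word n, (({x ∈ S | x + z ∈ S} : Finset (Word n)).card : ℝ) =
        ∑ x ∈ S, if x + z ∈ S then (1 : ℝ) else 0 := by
      intro z; simp
    simp only [this]
    rw [Finset.sum_comm]
    have h2 : ∀ x ∈ S, ∑ z : Word n, (if x + z ∈ S then (1 : ℝ) else 0) = S.card := by
      intro x _
      rw [Fintype.sum_equiv (Equiv.addLeft x) (fun z => if x + z ∈ S then (1 : ℝ) else 0)
        (fun w => if w ∈ S then (1 : ℝ) else 0) fun z => rfl]
      simp
    rw [Finset.sum_congr rfl h2]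
    simp [sq]
  have h3 : ∑ _z : Word n, (S.card : ℝ) ^ 2 <
      ∑ z : Word n, (({x ∈ S | x + z ∈ S} : Finset (Word n)).card : ℝ) * 2 ^ n :=
    Finset.sum_lt_sum_of_nonempty Finset.univ_nonempty fun z _ => h z
  rw [← Finset.sum_mul, h1, Finset.sum_const, Finset.card_univ, card_word, nsmul_eq_mul] at h3
  push_cast at h3
  linarith [mul_comm ((2 : ℝ) ^ n) ((S.card : ℝ) ^ 2)]

theorem card_sup_span_le {n : ℕ} (C : Submodule (ZMod 2) (Word n)) (z : Word n) :
    Nat.card (C ⊔ Submodule.span (ZMod 2) {z} : Submodule (ZMod 2) (Word n)) ≤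
      Nat.card C * 2 := by
  have hf : Function.Surjective (fun a : C × ZMod 2 =>
      (⟨a.1 + a.2 • z, Submodule.add_mem_sup a.1.2
        (Submodule.smul_mem _ _ (Submodule.mem_span_singleton_self z))⟩ :
        (C ⊔ Submodule.span (ZMod 2) {z} : Submodule (ZMod 2) (Word n)))) := by
    rintro ⟨y, hy⟩
    obtain ⟨c, hc, w, hw, rfl⟩ := Submodule.mem_sup.1 hy
    obtain ⟨a, rfl⟩ := Submodule.mem_span_singleton.1 hw
    exact ⟨(⟨c, hc⟩, a), rfl⟩
  have := Nat.card_le_card_of_surjective _ hf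
  rwa [Nat.card_prod, Nat.card_zmod] at this

/-- Each further generator of a linear code can be chosen so that the fraction of uncovered words is
squared. -/
theorem exists_code_card_uncovered_le {n : ℕ} (T : Finset (Word n)) (k : ℕ) :
    ∃ C : Submodule (ZMod 2) (Word n), Nat.card C ≤ 2 ^ k ∧
      ((uncovered T C).card : ℝ) ≤ 2 ^ n * (1 - (T.card : ℝ) / 2 ^ n) ^ 2 ^ k := by
  classical
  have hT : (T.card : ℝ) ≤ 2 ^ n := by
    have := Finset.card_le_univ T
    rw [card_word] at this
    exact_mod_cast this
  have h2n : (0 : ℝ) < 2 ^ n := by positivity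
  induction k with
  | zero =>
    refine ⟨⊥, by simp, ?_⟩
    have h1 : uncovered T ⊥ = Tᶜ := by
      ext x; simp [mem_uncovered]
    have h2 := Finset.card_add_card_compl T
    rw [card_word] at h2
    have h3 : (T.card : ℝ) + (Tᶜ.card : ℝ) = 2 ^ n := by exact_mod_cast h2
    rw [h1, pow_zero, pow_one, mul_sub, mul_div_cancel₀ _ h2n.ne']
    linarith
  | succ k ih =>
    obtain ⟨C, hC, hu⟩ := ih
    obtain ⟨z, hz⟩ := exists_card_shift_le (uncovered T C)
    refine ⟨C ⊔ Submodule.span (ZMod 2) {z}, ?_, ?_⟩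
    · rw [pow_succ]
      exact (card_sup_span_le C z).trans (Nat.mul_le_mul_right 2 hC)
    -- A word left uncovered by the enlarged code is left uncovered by `C`, and so is its translate
    -- by `z`; the choice of `z` makes this coincidence as rare as for independent events.
    · have hsub : uncovered T (C ⊔ Submodule.span (ZMod 2) {z}) ⊆
          {x ∈ uncovered T C | x + z ∈ uncovered T C} := by
        intro x hx
        rw [mem_uncovered] at hx
        rw [Finset.mem_filter, mem_uncovered, mem_uncovered]
        refine ⟨fun c hc => hx c (Submodule.mem_sup_left hc), fun c hc => ?_⟩
        rw [add_assoc, add_comm z c]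
        exact hx _ (Submodule.add_mem_sup hc (Submodule.mem_span_singleton_self z))
      have h1 : ((uncovered T (C ⊔ Submodule.span (ZMod 2) {z})).card : ℝ) * 2 ^ n ≤
          (2 ^ n * (1 - (T.card : ℝ) / 2 ^ n) ^ 2 ^ k) ^ 2 :=
        (mul_le_mul_of_nonneg_right (Nat.cast_le.2 (Finset.card_le_card hsub)) h2n.le).trans
          (hz.trans (pow_le_pow_left₀ (Nat.cast_nonneg _) hu 2))
      rw [mul_pow, sq ((2 : ℝ) ^ n), ← pow_mul, ← pow_succ] at h1
      refine le_of_mul_le_mul_right (h1.trans_eq ?_) h2n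
      ring

/-- There is a linear code of size about `n * 2 ^ n / |T|` that leaves at most a fraction
`exp (-n)` of the words uncovered. -/
theorem exists_covering_code {n : ℕ} (hn : 1 ≤ n) (T : Finset (Word n)) (hT : T.Nonempty) :
    ∃ C : Submodule (ZMod 2) (Word n), (Nat.card C : ℝ) * T.card ≤ 2 * n * 2 ^ n ∧
      ((uncovered T C).card : ℝ) ≤ 2 ^ n * Real.exp (-n) := by
  have hT0 : (0 : ℝ) < T.card := by exact_mod_cast hT.card_pos
  have hTn : (T.card : ℝ) ≤ 2 ^ n := by
    have := Finset.card_le_univ T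
    rw [card_word] at this
    exact_mod_cast this
  have h2n : (0 : ℝ) < 2 ^ n := by positivity
  have hex : ∃ k : ℕ, (n : ℝ) * 2 ^ n ≤ 2 ^ k * T.card := by
    obtain ⟨k, hk⟩ := pow_unbounded_of_one_lt ((n : ℝ) * 2 ^ n) (one_lt_two (α := ℝ))
    refine ⟨k, hk.le.trans (le_mul_of_one_le_right (by positivity) ?_)⟩
    exact_mod_cast hT.card_pos
  classical
  -- Minimality of `k` bounds the code size within a factor 2, while `2 ^ k * |T| ≥ n * 2 ^ n` turns
  -- `(1 - |T| / 2 ^ n) ^ 2 ^ k` into at most `exp (-n)`.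
  let k := Nat.find hex
  have hk : (n : ℝ) * 2 ^ n ≤ 2 ^ k * T.card := Nat.find_spec hex
  have hk' : (2 : ℝ) ^ k * T.card ≤ 2 * n * 2 ^ n := by
    have hn' : (1 : ℝ) ≤ n := by exact_mod_cast hn
    rcases Nat.eq_zero_or_pos k with h | h
    · rw [h, pow_zero, one_mul]
      nlinarith
    · have := Nat.find_min hex (show k - 1 < Nat.find hex from Nat.sub_lt h one_pos)
      rw [not_le] at this
      have h2 : (2 : ℝ) ^ k = 2 * 2 ^ (k - 1) := by rw [← pow_succ', Nat.sub_add_cancel h]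
      rw [h2]
      linarith
  obtain ⟨C, hC, hu⟩ := exists_code_card_uncovered_le T k
  refine ⟨C, ?_, hu.trans ?_⟩
  · have : (Nat.card C : ℝ) ≤ 2 ^ k := by exact_mod_cast hC
    exact (mul_le_mul_of_nonneg_right this hT0.le).trans hk'
  · refine mul_le_mul_of_nonneg_left ?_ h2n.le
    have h1 : 1 - (T.card : ℝ) / 2 ^ n ≤ Real.exp (-((T.card : ℝ) / 2 ^ n)) := by
      linarith [Real.add_one_le_exp (-((T.card : ℝ) / 2 ^ n))]
    have h0 : 0 ≤ 1 - (T.card : ℝ) / 2 ^ n := by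
      rw [sub_nonneg, div_le_one h2n]; exact hTn
    refine (pow_le_pow_left₀ h0 h1 _).trans ?_
    rw [← Real.exp_nat_mul]
    apply Real.exp_le_exp.2
    rw [mul_neg, neg_le_neg_iff, mul_div_assoc', le_div_iff₀ h2n]
    push_cast
    exact hk

/-- The quotient map by `C` followed by a linear section has kernel `C`. The rows of `U` need not be
independent: only V-syndromes are sent, so their number costs no rate. -/
theorem exists_parityCheck {n : ℕ} (C : Submodule (ZMod 2) (Word n)) :
    ∃ U : Matrix (Fin n) (Fin n) (ZMod 2), ∀ z, U.mulVec z = 0 ↔ z ∈ C := by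
  obtain ⟨g, hg⟩ := C.mkQ.exists_rightInverse_of_surjective C.range_mkQ
  refine ⟨LinearMap.toMatrix' (g ∘ₗ C.mkQ), fun z => ?_⟩
  rw [← Matrix.toLin'_apply, Matrix.toLin'_toMatrix', LinearMap.comp_apply]
  constructor
  · intro h
    have h1 := LinearMap.congr_fun hg (C.mkQ z)
    rw [LinearMap.comp_apply, h, map_zero, LinearMap.id_apply] at h1
    exact (Submodule.Quotient.mk_eq_zero C).1 h1.symm
  · intro h
    rw [Submodule.mkQ_apply, (Submodule.Quotient.mk_eq_zero C).2 h, map_zero]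

/-! ### Random binning by linear maps -/

theorem sum_dotProduct_eq_zero {n : ℕ} {d : Word n} (hd : d ≠ 0) :
    ∑ v : Word n, (if v ⬝ᵥ d = 0 then (1 : ℝ) else 0) = 2 ^ n / 2 := by
  obtain ⟨i, hi⟩ := Function.ne_iff.1 hd
  have hi1 : d i = 1 := (zmod_two_eq (d i)).resolve_left hi
  -- Flipping the coordinate `i` of `v`, where `d i = 1`, exchanges the two values of the product.
  have h1 : ∑ v : Word n, (if v ⬝ᵥ d = 0 then (1 : ℝ) else 0) =
      ∑ v : Word n, (if v ⬝ᵥ d = 0 then (0 : ℝ) else 1) := by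
    refine Fintype.sum_equiv (Equiv.addRight (Pi.single i 1)) _ _ fun v => ?_
    simp only [Equiv.coe_addRight, add_dotProduct, single_dotProduct, hi1, mul_one]
    have h11 : (1 : ZMod 2) + 1 = 0 := by decide
    rcases zmod_two_eq (v ⬝ᵥ d) with h | h <;> simp [h, h11]
  have h2 : ∑ v : Word n, (if v ⬝ᵥ d = 0 then (1 : ℝ) else 0) +
      ∑ v : Word n, (if v ⬝ᵥ d = 0 then (0 : ℝ) else 1) = 2 ^ n := by
    rw [← Finset.sum_add_distrib]
    have : ∀ v : Word n, (if v ⬝ᵥ d = 0 then (1 : ℝ) else 0) +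
        (if v ⬝ᵥ d = 0 then (0 : ℝ) else 1) = 1 := fun v => by split_ifs <;> norm_num
    simp [this]
  linarith

/-- Some linear map to `r` bits annihilates at most a fraction `2 ^ (-r)` of the weight of a set of
nonzero words. -/
theorem exists_binning {n : ℕ} (S : Finset (Word n)) (hS : (0 : Word n) ∉ S) (w : Word n → ℝ)
    (r : ℕ) : ∃ V : Matrix (Fin r) (Fin n) (ZMod 2),
      (∑ d ∈ S, if V.mulVec d = 0 then w d else 0) ≤ (1 / 2) ^ r * ∑ d ∈ S, w d := by
  induction r with
  | zero =>
    refine ⟨0, ?_⟩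
    simp
  | succ r ih =>
    obtain ⟨V, hV⟩ := ih
    -- A nonzero `d` is orthogonal to exactly half of all rows `v`, so an average new row halves the
    -- surviving weight.
    have hex : ∃ v : Word n, (∑ d ∈ S, if V.mulVec d = 0 then
        w d * (if v ⬝ᵥ d = 0 then (1 : ℝ) else 0) else 0) ≤
        1 / 2 * ∑ d ∈ S, if V.mulVec d = 0 then w d else 0 := by
      by_contra! h
      have h1 := Finset.sum_lt_sum_of_nonempty (Finset.univ_nonempty (α := Word n))
        fun v _ => h v
      rw [Finset.sum_comm, Finset.sum_const, Finset.card_univ, card_word, nsmul_eq_mul] at h1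
      have h2 : ∀ d ∈ S, (∑ v : Word n, if V.mulVec d = 0 then
          w d * (if v ⬝ᵥ d = 0 then (1 : ℝ) else 0) else 0) =
          2 ^ n / 2 * (if V.mulVec d = 0 then w d else 0) := by
        intro d hd
        split_ifs with hVd
        · rw [← Finset.mul_sum, sum_dotProduct_eq_zero (fun h0 => hS (h0 ▸ hd)), mul_comm]
        · simp
      rw [Finset.sum_congr rfl h2, ← Finset.mul_sum] at h1
      push_cast at h1
      linarith
    obtain ⟨v, hv⟩ := hex
    refine ⟨Matrix.of (Fin.cons v V), ?_⟩
    have h3 : ∀ d, (Matrix.of (Fin.cons v V : Fin (r + 1) → Word n)).mulVec d = 0 ↔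
        v ⬝ᵥ d = 0 ∧ V.mulVec d = 0 := by
      intro d
      constructor
      · intro h
        exact ⟨congrFun h 0, funext fun i => congrFun h i.succ⟩
      · rintro ⟨ha, hb⟩
        funext i
        refine Fin.cases ?_ (fun j => ?_) i
        · exact ha
        · exact congrFun hb j
    have h4 : ∀ d, (if (Matrix.of (Fin.cons v V : Fin (r + 1) → Word n)).mulVec d = 0 then w d
        else 0) = if V.mulVec d = 0 then
        w d * (if v ⬝ᵥ d = 0 then (1 : ℝ) else 0) else 0 := by
      intro d
      simp only [h3]
      by_cases ha : v ⬝ᵥ d = 0 <;> by_cases hb : V.mulVec d = 0 <;> simp [ha, hb]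
    simp only [h4]
    rw [pow_succ]
    linarith

/-! ### The dithered linear scheme as a sum of quantization errors -/

theorem mulVec_quantize {m n : ℕ} (U : Matrix (Fin m) (Fin n) (ZMod 2)) (x : Word n) :
    U.mulVec (quantize U x) = 0 :=
  Function.argminOn_mem (fun z : Word n => hammingNorm (x + z)) {z : Word n | U.mulVec z = 0}
    ⟨0, U.mulVec_zero⟩

theorem hammingNorm_add_quantize_le {m n : ℕ} (U : Matrix (Fin m) (Fin n) (ZMod 2))
    (x : Word n) {z : Word n} (hz : U.mulVec z = 0) :
    hammingNorm (x + quantize U x) ≤ hammingNorm (x + z) :=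
  Function.argminOn_le (fun z : Word n => hammingNorm (x + z)) {z : Word n | U.mulVec z = 0} hz

/-- The quantization error. -/
noncomputable def qerr {m n : ℕ} (U : Matrix (Fin m) (Fin n) (ZMod 2)) (u : Word n) : Word n :=
  u + quantize U u

/-- The decoder of the linear scheme, as a function of the word whose syndromes it is given. -/
noncomputable def recon {m r n : ℕ} (U : Matrix (Fin m) (Fin n) (ZMod 2))
    (V : Matrix (Fin r) (Fin n) (ZMod 2)) (w : Word n) : Word n :=
  minWeightDec U V (V.mulVec w) 0 (U.mulVec w)

theorem minWeightDec_eq {m r n : ℕ} (U : Matrix (Fin m) (Fin n) (ZMod 2))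
    (V : Matrix (Fin r) (Fin n) (ZMod 2)) (a b : Word r) (s : Word m) :
    minWeightDec U V a b s = minWeightDec U V (a + b) 0 s := by
  unfold minWeightDec
  congr! 1 <;> simp only [add_zero]

theorem recon_spec {m r n : ℕ} (U : Matrix (Fin m) (Fin n) (ZMod 2))
    (V : Matrix (Fin r) (Fin n) (ZMod 2)) (w : Word n) :
    U.mulVec (recon U V w) = U.mulVec w ∧ V.mulVec (recon U V w) = V.mulVec w ∧
      hammingNorm (recon U V w) ≤ hammingNorm w := by
  have hw : w ∈ {z : Word n | U.mulVec z = U.mulVec w ∧ V.mulVec z = V.mulVec w + 0} :=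
    ⟨rfl, (add_zero _).symm⟩
  have hne : {z : Word n | U.mulVec z = U.mulVec w ∧ V.mulVec z = V.mulVec w + 0}.Nonempty :=
    ⟨w, hw⟩
  have hr : recon U V w = Function.argminOn (fun z : Word n => hammingNorm z) _ hne := by
    unfold recon minWeightDec
    rw [dif_pos hne]
  have hmem := Function.argminOn_mem (fun z : Word n => hammingNorm z) _ hne
  rw [← hr] at hmem
  refine ⟨hmem.1, hmem.2.trans (add_zero _), ?_⟩
  rw [hr]
  exact Function.argminOn_le (fun z : Word n => hammingNorm z) _ hw

theorem syndromeEnc_add {m r n : ℕ} (U : Matrix (Fin m) (Fin n) (ZMod 2))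
    (V : Matrix (Fin r) (Fin n) (ZMod 2)) (x d : Word n) :
    syndromeEnc U V (x + d) + V.mulVec d = V.mulVec (x + qerr U (x + d)) := by
  have h : quantize U (x + d) + d = x + qerr U (x + d) := by
    rw [qerr, add_assoc x d, word_add_cancel, add_comm]
  rw [syndromeEnc, ← Matrix.mulVec_add, h]

/-- The sum of source and error differs from the dither by a codeword. Hence the decoder knows its
U-syndrome without receiving anything. -/
theorem mulVec_add_qerr {m n : ℕ} (U : Matrix (Fin m) (Fin n) (ZMod 2)) (x d : Word n) :
    U.mulVec (x + qerr U (x + d)) = U.mulVec d := by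
  have : x + qerr U (x + d) = d + quantize U (x + d) := by
    rw [qerr, add_assoc x d, word_add_cancel]
  rw [this, Matrix.mulVec_add, mulVec_quantize, add_zero]

theorem ditheredDistortion_eq (p : ℝ) {m r n : ℕ} (U : Matrix (Fin m) (Fin n) (ZMod 2))
    (V : Matrix (Fin r) (Fin n) (ZMod 2)) (dX dY : Word n) :
    ditheredDistortion p U V dX dY = expect p fun x y =>
      distortion (x + y) (recon U V (x + y + qerr U (x + dX) + qerr U (y + dY))) := by
  unfold ditheredDistortion lkmDistortion
  congr 1
  funext x y
  congr 1
  beta_reduce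
  have h : x + y + qerr U (x + dX) + qerr U (y + dY) =
      (x + qerr U (x + dX)) + (y + qerr U (y + dY)) := by abel
  rw [minWeightDec_eq, syndromeEnc_add, syndromeEnc_add, h, recon, ← Matrix.mulVec_add V,
    Matrix.mulVec_add U dX dY, Matrix.mulVec_add U (x + qerr U (x + dX)), mulVec_add_qerr,
    mulVec_add_qerr]

/-- The pair is `(X, X + Z)` with `X` uniform and `Z` an independent Bernoulli word. -/
theorem expect_add (p : ℝ) {n : ℕ} (F : Word n → ℝ) :
    expect p (fun x y => F (x + y)) = ∑ z, bernWord p z * F z := by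
  have h1 : ∀ x z : Word n, dsbsLaw p x (x + z) = 1 / 2 ^ n * bernWord p z := by
    intro x z
    have : ∀ i, dsbs p (x i) ((x + z) i) = 1 / 2 * bern p (z i) := by
      intro i
      unfold dsbs bern
      by_cases h : z i = 0
      · simp [h]; ring
      · simp [h]; ring
    simp only [dsbsLaw, this, Finset.prod_mul_distrib, bernWord]
    simp
  have h2 : ∀ x : Word n, ∑ y, dsbsLaw p x y * F (x + y) =
      ∑ z, 1 / 2 ^ n * bernWord p z * F z := by
    intro x
    symm
    refine Fintype.sum_equiv (Equiv.addLeft x) _ _ fun z => ?_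
    simp only [Equiv.coe_addLeft, h1, word_add_cancel]
  simp only [expect, h2, Finset.sum_const, Finset.card_univ, card_word, nsmul_eq_mul]
  rw [Finset.mul_sum]
  refine Finset.sum_congr rfl fun z _ => ?_
  push_cast
  field_simp

/-- The mean of `F (z, u, v)` for independent `z`, `u`, `v`, where `z` has the Bernoulli law with
parameter `p` and `u`, `v` are uniform. -/
noncomputable def mean (p : ℝ) {n : ℕ} (F : Word n → Word n → Word n → ℝ) : ℝ :=
  ∑ z, bernWord p z * ∑ u, ∑ v, 1 / 2 ^ n * (1 / 2 ^ n) * F z u v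

theorem mean_mono {p : ℝ} (h0 : 0 ≤ p) (h1 : p ≤ 1) {n : ℕ}
    {F G : Word n → Word n → Word n → ℝ} (h : ∀ z u v, F z u v ≤ G z u v) :
    mean p F ≤ mean p G := by
  refine Finset.sum_le_sum fun z _ => mul_le_mul_of_nonneg_left ?_ (bernWord_nonneg h0 h1 z)
  refine Finset.sum_le_sum fun u _ => Finset.sum_le_sum fun v _ => ?_
  exact mul_le_mul_of_nonneg_left (h z u v) (by positivity)

theorem mean_add (p : ℝ) {n : ℕ} (F G : Word n → Word n → Word n → ℝ) :
    mean p (fun z u v => F z u v + G z u v) = mean p F + mean p G := by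
  simp only [mean, mul_add, Finset.sum_add_distrib]

theorem mean_const (p : ℝ) (n : ℕ) (c : ℝ) :
    mean p (fun _ _ _ : Word n => c) = c := by
  have h : (2 : ℝ) ^ n ≠ 0 := by positivity
  simp only [mean, Finset.sum_const, Finset.card_univ, card_word, nsmul_eq_mul]
  rw [← Finset.sum_mul, sum_bernWord]
  push_cast
  field_simp

theorem mean_sum (p : ℝ) {n : ℕ} {ι : Type*} (S : Finset ι)
    (F : ι → Word n → Word n → Word n → ℝ) :
    mean p (fun z u v => ∑ i ∈ S, F i z u v) = ∑ i ∈ S, mean p (F i) := by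
  classical
  induction S using Finset.induction_on with
  | empty => simpa using mean_const p n 0
  | insert i S hi ih =>
    simp only [Finset.sum_insert hi]
    rw [mean_add, ih]

theorem sum_comm_four {α β γ δ : Type*} [Fintype α] [Fintype β] [Fintype γ] [Fintype δ]
    (T : α → β → γ → δ → ℝ) :
    ∑ a, ∑ b, ∑ c, ∑ d, T a b c d = ∑ c, ∑ d, ∑ a, ∑ b, T a b c d := by
  have := Finset.sum_comm (s := (Finset.univ : Finset (α × β)))
    (t := (Finset.univ : Finset (γ × δ))) (f := fun x y => T x.1 x.2 y.1 y.2)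
  simpa only [Fintype.sum_prod_type] using this

/-- For fixed `x` and `y` the words `x + dX` and `y + dY` are uniform and independent, so the
quantization errors become independent of the source. -/
theorem average_ditheredDistortion (p : ℝ) {m r n : ℕ} (U : Matrix (Fin m) (Fin n) (ZMod 2))
    (V : Matrix (Fin r) (Fin n) (ZMod 2)) :
    (∑ dX : Word n, ∑ dY : Word n,
      (1 / 2 ^ n : ℝ) * (1 / 2 ^ n : ℝ) * ditheredDistortion p U V dX dY) =
    mean p fun z u v => distortion z (recon U V (z + qerr U u + qerr U v)) := by
  have h : ∀ x y : Word n, (∑ dX : Word n, ∑ dY : Word n, (1 / 2 ^ n : ℝ) * (1 / 2 ^ n : ℝ) *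
      distortion (x + y) (recon U V (x + y + qerr U (x + dX) + qerr U (y + dY)))) =
      ∑ u : Word n, ∑ v : Word n, (1 / 2 ^ n : ℝ) * (1 / 2 ^ n : ℝ) *
      distortion (x + y) (recon U V (x + y + qerr U u + qerr U v)) := by
    intro x y
    refine Fintype.sum_equiv (Equiv.addLeft x) _ _ fun u => ?_
    exact Fintype.sum_equiv (Equiv.addLeft y) _ _ fun v => rfl
  rw [mean, ← expect_add p (fun z => ∑ u : Word n, ∑ v : Word n,
    (1 / 2 ^ n : ℝ) * (1 / 2 ^ n) * distortion z (recon U V (z + qerr U u + qerr U v)))]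
  simp only [ditheredDistortion_eq, expect, ← h, Finset.mul_sum]
  rw [sum_comm_four]
  exact Finset.sum_congr rfl fun x _ => Finset.sum_congr rfl fun y _ =>
    Finset.sum_congr rfl fun u _ => Finset.sum_congr rfl fun v _ => by ring

/-! ### Change of measure for the quantization errors -/

-- A word plus its error is its quantization, so all words with error `a` lie in the coset `a + C`.
open Classical in
theorem card_fiber_qerr_le {m n : ℕ} (U : Matrix (Fin m) (Fin n) (ZMod 2))
    (C : Submodule (ZMod 2) (Word n)) (hU : ∀ z, U.mulVec z = 0 ↔ z ∈ C) (a : Word n) :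
    ({u | qerr U u = a} : Finset (Word n)).card ≤ Nat.card C := by
  rw [Nat.card_eq_fintype_card, Fintype.card_subtype]
  refine Finset.card_le_card_of_injOn (fun u => u + a) (fun u hu => ?_)
    (add_left_injective a).injOn
  have : qerr U u = a := by simpa using hu
  have hmem : u + a ∈ C := by
    rw [← this, qerr, word_add_cancel, ← hU]
    exact mulVec_quantize U u
  simpa using hmem

/-- An error outside the ball comes from an uncovered word and costs at most `b`. An error inside it
arises from at most `|C|` words and has Bernoulli mass at least `2 ^ (-(n * ell q a))`, which gives
the factor of the change of measure. -/
theorem sum_qerr_le {m n : ℕ} (U : Matrix (Fin m) (Fin n) (ZMod 2))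
    (C : Submodule (ZMod 2) (Word n)) (hU : ∀ z, U.mulVec z = 0 ↔ z ∈ C) {q : ℝ} (h0 : 0 < q)
    (h1 : q ≤ 1 / 2) (a b : ℝ) (G : Word n → ℝ) (hG0 : ∀ w, 0 ≤ G w) (hGb : ∀ w, G w ≤ b) :
    ∑ u, G (qerr U u) ≤ (uncovered (ball n a) C).card * b +
      Nat.card C * (2 : ℝ) ^ (n * ell q a) * ∑ e, bernWord q e * G e := by
  classical
  have hunc : ∀ u, qerr U u ∉ ball n a → u ∈ uncovered (ball n a) C := by
    intro u hu
    rw [mem_uncovered]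
    intro c hc hmem
    refine hu (mem_ball.2 (le_trans ?_ (mem_ball.1 hmem)))
    exact_mod_cast hammingNorm_add_quantize_le U u ((hU c).2 hc)
  have hb : 0 ≤ b := (hG0 0).trans (hGb 0)
  have hA : ∑ u, G (qerr U u) ≤ ∑ u, ((if u ∈ uncovered (ball n a) C then b else 0) +
      if qerr U u ∈ ball n a then G (qerr U u) else 0) := by
    refine Finset.sum_le_sum fun u _ => ?_
    by_cases h : qerr U u ∈ ball n a
    · rw [if_pos h]
      have : 0 ≤ (if u ∈ uncovered (ball n a) C then b else 0) := by
        split_ifs <;> simp [hb]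
      linarith
    · rw [if_neg h, if_pos (hunc u h)]
      linarith [hGb (qerr U u)]
  have hB : ∑ u, (if u ∈ uncovered (ball n a) C then b else 0) =
      (uncovered (ball n a) C).card * b := by
    simp
  have hC : ∑ u, (if qerr U u ∈ ball n a then G (qerr U u) else 0) ≤
      Nat.card C * (2 : ℝ) ^ (n * ell q a) * ∑ e, bernWord q e * G e := by
    rw [← Finset.sum_fiberwise_of_maps_to (s := Finset.univ) (t := Finset.univ) (g := qerr U)
      (fun _ _ => Finset.mem_univ _), Finset.mul_sum]
    refine Finset.sum_le_sum fun e _ => ?_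
    have h2 : ∀ u ∈ ({u | qerr U u = e} : Finset (Word n)),
        (if qerr U u ∈ ball n a then G (qerr U u) else 0) ≤
          (2 : ℝ) ^ (n * ell q a) * (bernWord q e * G e) := by
      intro u hu
      have hue : qerr U u = e := by simpa using hu
      have hnn : 0 ≤ (2 : ℝ) ^ (n * ell q a) * (bernWord q e * G e) :=
        mul_nonneg (by positivity) (mul_nonneg (bernWord_nonneg h0.le (by linarith) e) (hG0 e))
      rw [hue]
      split_ifs with h
      · have h3 := le_bernWord h0 h1 (mem_ball.1 h)
        rw [Real.rpow_neg (by norm_num), inv_le_iff_one_le_mul₀ (by positivity)] at h3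
        have := mul_le_mul_of_nonneg_right h3 (hG0 e)
        linarith
      · exact hnn
    refine (Finset.sum_le_card_nsmul _ _ _ h2).trans ?_
    rw [nsmul_eq_mul, mul_assoc]
    refine mul_le_mul_of_nonneg_right (by exact_mod_cast card_fiber_qerr_le U C hU e) ?_
    exact mul_nonneg (by positivity) (mul_nonneg (bernWord_nonneg h0.le (by linarith) e) (hG0 e))
  rw [Finset.sum_add_distrib, hB] at hA
  linarith

/-- Up to the words that the code leaves uncovered, sums over two quantization errors are bounded by
sums over two independent Bernoulli words. -/
theorem sum_sum_qerr_le {m n : ℕ} (U : Matrix (Fin m) (Fin n) (ZMod 2))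
    (C : Submodule (ZMod 2) (Word n)) (hU : ∀ z, U.mulVec z = 0 ↔ z ∈ C) {q : ℝ} (h0 : 0 < q)
    (h1 : q ≤ 1 / 2) (a : ℝ) (G : Word n → ℝ) (hG0 : ∀ w, 0 ≤ G w) (hG1 : ∀ w, G w ≤ 1)
    {β K : ℝ} (hβ : ((uncovered (ball n a) C).card : ℝ) ≤ 2 ^ n * β)
    (hK : (Nat.card C : ℝ) * (2 : ℝ) ^ (n * ell q a) ≤ 2 ^ n * K) :
    ∑ u, ∑ v, 1 / 2 ^ n * (1 / 2 ^ n) * G (qerr U u + qerr U v) ≤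
      β + K * β + K ^ 2 * ∑ w, bernWord (bconv q q) w * G w := by
  have h2n : (0 : ℝ) < 2 ^ n := by positivity
  have hb := fun e : Word n => bernWord_nonneg (n := n) h0.le (by linarith : q ≤ 1) e
  have hβ0 : 0 ≤ β := nonneg_of_mul_nonneg_right ((Nat.cast_nonneg _).trans hβ) h2n
  have hK0 : 0 ≤ K := by
    refine nonneg_of_mul_nonneg_right (le_trans ?_ hK) h2n
    positivity
  have key : ∀ H : Word n → ℝ, (∀ w, 0 ≤ H w) → (∀ w, H w ≤ 1) →
      ∑ u, 1 / 2 ^ n * H (qerr U u) ≤ β + K * ∑ e, bernWord q e * H e := by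
    intro H hH0 hH1
    have hS : 0 ≤ ∑ e, bernWord q e * H e :=
      Finset.sum_nonneg fun e _ => mul_nonneg (hb e) (hH0 e)
    have h3 := sum_qerr_le U C hU h0 h1 a 1 H hH0 hH1
    rw [← Finset.mul_sum, one_div, inv_mul_le_iff₀ h2n]
    have := mul_le_mul_of_nonneg_right hK hS
    linarith
  calc ∑ u, ∑ v, 1 / 2 ^ n * (1 / 2 ^ n) * G (qerr U u + qerr U v)
      = ∑ u, 1 / 2 ^ n * ∑ v, 1 / 2 ^ n * G (qerr U u + qerr U v) := by
        simp only [Finset.mul_sum, mul_assoc]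
    _ ≤ ∑ u : Word n, 1 / 2 ^ n * (β + K * ∑ e, bernWord q e * G (qerr U u + e)) := by
        refine Finset.sum_le_sum fun u _ => mul_le_mul_of_nonneg_left ?_ (by positivity)
        exact key (fun w => G (qerr U u + w)) (fun _ => hG0 _) fun _ => hG1 _
    _ = β + K * ∑ e, bernWord q e * ∑ u, 1 / 2 ^ n * G (qerr U u + e) := by
        simp only [mul_add, Finset.sum_add_distrib]
        congr 1
        · simp
        · simp only [Finset.mul_sum]
          rw [Finset.sum_comm]
          exact Finset.sum_congr rfl fun _ _ => Finset.sum_congr rfl fun _ _ => by ring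
    -- The second change of measure, now with the Bernoulli word `e` fixed; its uncovered part is
    -- multiplied by the `K` of the first, whence `K * β`.
    _ ≤ β + K * ∑ e, bernWord q e * (β + K * ∑ f, bernWord q f * G (e + f)) := by
        refine add_le_add_right (mul_le_mul_of_nonneg_left ?_ hK0) β
        refine Finset.sum_le_sum fun e _ => mul_le_mul_of_nonneg_left ?_ (hb e)
        simp only [add_comm _ e]
        exact key (fun w => G (e + w)) (fun _ => hG0 _) fun _ => hG1 _
    _ = β + K * β + K ^ 2 * ∑ w, bernWord (bconv q q) w * G w := by
        simp only [mul_add, Finset.sum_add_distrib]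
        rw [← Finset.sum_mul, sum_bernWord, one_mul, ← sum_bernWord_conv, Finset.mul_sum,
          Finset.mul_sum]
        simp only [Finset.mul_sum, add_assoc]
        congr 2
        exact Finset.sum_congr rfl fun _ _ => Finset.sum_congr rfl fun _ _ => by ring

theorem mean_qerr_le {p : ℝ} (hp0 : 0 ≤ p) (hp1 : p ≤ 1) {m n : ℕ}
    (U : Matrix (Fin m) (Fin n) (ZMod 2))
    (C : Submodule (ZMod 2) (Word n)) (hU : ∀ z, U.mulVec z = 0 ↔ z ∈ C) {q : ℝ} (h0 : 0 < q)
    (h1 : q ≤ 1 / 2) (a : ℝ) (G : Word n → ℝ) (hG0 : ∀ w, 0 ≤ G w) (hG1 : ∀ w, G w ≤ 1)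
    {β K : ℝ} (hβ : ((uncovered (ball n a) C).card : ℝ) ≤ 2 ^ n * β)
    (hK : (Nat.card C : ℝ) * (2 : ℝ) ^ (n * ell q a) ≤ 2 ^ n * K) :
    mean p (fun z u v => G (z + qerr U u + qerr U v)) ≤
      β + K * β + K ^ 2 * ∑ w, bernWord (bconv (bconv p q) q) w * G w := by
  have hc : bconv (bconv p q) q = bconv p (bconv q q) := by unfold bconv; ring
  rw [hc, ← sum_bernWord_conv, mean]
  have h : ∀ z : Word n, bernWord p z * ∑ u, ∑ v, 1 / 2 ^ n * (1 / 2 ^ n) *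
      G (z + qerr U u + qerr U v) ≤ bernWord p z * (β + K * β) +
      K ^ 2 * (bernWord p z * ∑ w, bernWord (bconv q q) w * G (z + w)) := by
    intro z
    have := sum_sum_qerr_le U C hU h0 h1 a (fun w => G (z + w)) (fun _ => hG0 _)
      (fun _ => hG1 _) hβ hK
    simp only [add_assoc] at this ⊢
    have := mul_le_mul_of_nonneg_left this (bernWord_nonneg hp0 hp1 z)
    linarith
  refine (Finset.sum_le_sum fun z _ => h z).trans_eq ?_
  rw [Finset.sum_add_distrib, ← Finset.sum_mul, sum_bernWord, one_mul, ← Finset.mul_sum]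

/-! ### The expected number of competitors -/

/-- Replacing the errors by the words themselves moves the argument by a codeword, which only
permutes the terms of a sum over the code. -/
theorem qerr_sum_shift {m n : ℕ} (U : Matrix (Fin m) (Fin n) (ZMod 2)) (S : Finset (Word n))
    (hS : ∀ z, z ∈ S ↔ U.mulVec z = 0) (f : Word n → ℝ) (z u v : Word n) :
    ∑ c ∈ S, f (z + qerr U u + qerr U v + c) = ∑ c ∈ S, f (z + u + v + c) := by
  have hm : ∀ c ∈ S, quantize U u + quantize U v + c ∈ S := by
    intro c hc
    rw [hS] at hc ⊢
    rw [Matrix.mulVec_add, Matrix.mulVec_add, mulVec_quantize, mulVec_quantize, hc]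
    simp
  refine Finset.sum_bij' (fun c _ => quantize U u + quantize U v + c)
    (fun c _ => quantize U u + quantize U v + c) hm hm
    (fun c _ => word_add_cancel _ _) (fun c _ => word_add_cancel _ _) fun c _ => ?_
  congr 1
  unfold qerr
  abel

-- The count is exact and needs nothing about the law of the errors: after the shift by codewords
-- the argument contains the uniform word `v`.
open Classical in
theorem sum_mean_ball {m n : ℕ} (p : ℝ) (U : Matrix (Fin m) (Fin n) (ZMod 2))
    (S : Finset (Word n)) (hS : ∀ z, z ∈ S ↔ U.mulVec z = 0) (B : Finset (Word n)) :
    ∑ c ∈ S, mean p (fun z u v => if z + qerr U u + qerr U v + c ∈ B then 1 else 0) =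
      S.card * B.card / 2 ^ n := by
  rw [← mean_sum]
  have h1 : ∀ z u v : Word n, (∑ c ∈ S, if z + qerr U u + qerr U v + c ∈ B then (1 : ℝ) else 0) =
      ∑ c ∈ S, if z + u + v + c ∈ B then (1 : ℝ) else 0 := fun z u v =>
    qerr_sum_shift U S hS (fun w => if w ∈ B then 1 else 0) z u v
  simp only [h1]
  rw [mean_sum]
  have h2 : ∀ c ∈ S, mean p (fun z u v : Word n => if z + u + v + c ∈ B then (1 : ℝ) else 0) =
      B.card / 2 ^ n := by
    intro c _
    have h3 : ∀ z u : Word n, ∑ v, (if z + u + v + c ∈ B then (1 : ℝ) else 0) = B.card := by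
      intro z u
      rw [Fintype.sum_equiv (Equiv.addLeft (z + u + c)) _ (fun w => if w ∈ B then (1 : ℝ) else 0)
        fun v => by simp only [Equiv.coe_addLeft, add_right_comm]]
      simp
    have h4 : (2 : ℝ) ^ n ≠ 0 := by positivity
    simp only [mean, ← Finset.mul_sum, h3, Finset.sum_const, Finset.card_univ, card_word,
      nsmul_eq_mul]
    rw [← Finset.sum_mul, sum_bernWord]
    push_cast
    field_simp
  rw [Finset.sum_congr rfl h2, Finset.sum_const, nsmul_eq_mul, mul_div_assoc]

/-! ### The distortion of a pair of matrices -/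

theorem distortion_le_one {n : ℕ} (z w : Word n) : distortion z w ≤ 1 := by
  unfold distortion
  refine div_le_one_of_le₀ ?_ (Nat.cast_nonneg _)
  exact_mod_cast (hammingDist_le_card_fintype (x := z) (y := w)).trans_eq (Fintype.card_fin n)

-- A union bound: either the sum of the errors is heavy, or `z + e` is heavy, or a nonzero codeword
-- killed by `V` leads to another word of the ball. The distortion is at most 1 in these cases and
-- below `D₀` otherwise.
open Classical in
theorem distortion_recon_le {m r n : ℕ} (hn : 1 ≤ n) (U : Matrix (Fin m) (Fin n) (ZMod 2))
    (V : Matrix (Fin r) (Fin n) (ZMod 2)) {D₀ : ℝ} (hD₀ : 0 ≤ D₀) (t : ℝ) (S : Finset (Word n))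
    (hS : ∀ z, z ∈ S ↔ U.mulVec z = 0) (z e : Word n) :
    distortion z (recon U V (z + e)) ≤ D₀ + (if n * D₀ ≤ (hammingNorm e : ℝ) then 1 else 0) +
      (if n * t ≤ (hammingNorm (z + e) : ℝ) then 1 else 0) +
      ∑ c ∈ S.erase 0, if V.mulVec c = 0 then (if z + e + c ∈ ball n t then (1 : ℝ) else 0)
        else 0 := by
  have hn0 : (0 : ℝ) < n := by exact_mod_cast hn
  have hs0 : ∀ c ∈ S.erase 0, (0 : ℝ) ≤ if V.mulVec c = 0 then
      (if z + e + c ∈ ball n t then (1 : ℝ) else 0) else 0 := by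
    intro c _; split_ifs <;> norm_num
  have hsum := Finset.sum_nonneg hs0
  have i1 : (0 : ℝ) ≤ if n * D₀ ≤ (hammingNorm e : ℝ) then 1 else 0 := by
    split_ifs <;> norm_num
  have i2 : (0 : ℝ) ≤ if n * t ≤ (hammingNorm (z + e) : ℝ) then 1 else 0 := by
    split_ifs <;> norm_num
  have h1 := distortion_le_one z (recon U V (z + e))
  obtain ⟨hrU, hrV, hrw⟩ := recon_spec U V (z + e)
  by_cases hR : recon U V (z + e) = z + e
  · by_cases hA : n * D₀ ≤ (hammingNorm e : ℝ)
    · rw [if_pos hA]; linarith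
    · have : distortion z (recon U V (z + e)) ≤ D₀ := by
        rw [hR, distortion, div_le_iff₀ hn0, hammingDist_eq_hammingNorm, neg_add_cancel_left]
        linarith
      linarith
  · by_cases hB : n * t ≤ (hammingNorm (z + e) : ℝ)
    · rw [if_pos hB]; linarith
    -- The competitor: the difference between the true word and a decoded word of no greater weight
    -- with the same two syndromes.
    · set c := z + e + recon U V (z + e) with hc
      have hec : z + e + c = recon U V (z + e) := word_add_cancel _ _
      have hcS : c ∈ S.erase 0 := by
        rw [Finset.mem_erase, hS, hc, Matrix.mulVec_add, hrU, word_add_self]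
        refine ⟨fun h => hR ?_, rfl⟩
        rw [← hec, hc, h, add_zero]
      have hterm : (1 : ℝ) = if V.mulVec c = 0 then
          (if z + e + c ∈ ball n t then (1 : ℝ) else 0) else 0 := by
        rw [if_pos, if_pos]
        · rw [hec, mem_ball]
          exact (Nat.cast_le.2 hrw).trans (not_le.1 hB).le
        · rw [hc, Matrix.mulVec_add, hrV, word_add_self]
      have := Finset.single_le_sum hs0 hcS
      rw [← hterm] at this
      linarith

/-- The dithered linear scheme with a quantizer of kernel `C` and a suitable binning matrix. -/
theorem exists_average_ditheredDistortion_le {p : ℝ} (hp0 : 0 ≤ p) (hp1 : p ≤ 1) {m n : ℕ}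
    (hn : 1 ≤ n) (U : Matrix (Fin m) (Fin n) (ZMod 2))
    (C : Submodule (ZMod 2) (Word n)) (hU : ∀ z, U.mulVec z = 0 ↔ z ∈ C) {q : ℝ} (h0 : 0 < q)
    (h1 : q ≤ 1 / 2) (a t : ℝ) {D₀ : ℝ} (hD₀ : 0 ≤ D₀) (r : ℕ)
    {β K ρ₁ ρ₂ : ℝ} (hβ : ((uncovered (ball n a) C).card : ℝ) ≤ 2 ^ n * β)
    (hK : (Nat.card C : ℝ) * (2 : ℝ) ^ (n * ell q a) ≤ 2 ^ n * K)
    (hρ₁ : ∑ w : Word n, bernWord (bconv q q) w *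
      (if n * D₀ ≤ (hammingNorm w : ℝ) then 1 else 0) ≤ ρ₁)
    (hρ₂ : ∑ w : Word n, bernWord (bconv (bconv p q) q) w *
      (if n * t ≤ (hammingNorm w : ℝ) then 1 else 0) ≤ ρ₂) :
    ∃ V : Matrix (Fin r) (Fin n) (ZMod 2),
      (∑ dX : Word n, ∑ dY : Word n,
        (1 / 2 ^ n : ℝ) * (1 / 2 ^ n : ℝ) * ditheredDistortion p U V dX dY) ≤
      D₀ + (β + K * β + K ^ 2 * ρ₁) + (β + K * β + K ^ 2 * ρ₂) +
        (1 / 2) ^ r * (Nat.card C * (ball n t).card / 2 ^ n) := by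
  classical
  let S : Finset (Word n) := {c | c ∈ C}
  have hS : ∀ z, z ∈ S ↔ U.mulVec z = 0 := fun z => by simp [S, hU]
  have hScard : S.card = Nat.card C := by
    rw [Nat.card_eq_fintype_card, Fintype.card_subtype]
  let w : Word n → ℝ := fun c =>
    mean p fun z u v => if z + qerr U u + qerr U v + c ∈ ball n t then 1 else 0
  obtain ⟨V, hV⟩ := exists_binning (S.erase 0) (Finset.notMem_erase 0 S) w r
  refine ⟨V, ?_⟩
  rw [average_ditheredDistortion]
  have hle : ∀ z u v : Word n, distortion z (recon U V (z + qerr U u + qerr U v)) ≤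
      D₀ + (if n * D₀ ≤ (hammingNorm (qerr U u + qerr U v) : ℝ) then 1 else 0) +
      (if n * t ≤ (hammingNorm (z + qerr U u + qerr U v) : ℝ) then 1 else 0) +
      ∑ c ∈ S.erase 0, if V.mulVec c = 0 then
        (if z + qerr U u + qerr U v + c ∈ ball n t then (1 : ℝ) else 0) else 0 := by
    intro z u v
    have := distortion_recon_le hn U V hD₀ t S hS z (qerr U u + qerr U v)
    simpa only [← add_assoc] using this
  refine (mean_mono hp0 hp1 hle).trans ?_
  rw [mean_add, mean_add, mean_add, mean_const, mean_sum]
  have g0 : ∀ s w : ℝ, (0 : ℝ) ≤ if s ≤ w then 1 else 0 := by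
    intro s w; split_ifs <;> norm_num
  have g1 : ∀ s w : ℝ, (if s ≤ w then (1 : ℝ) else 0) ≤ 1 := by
    intro s w; split_ifs <;> norm_num
  have hK2 : 0 ≤ K ^ 2 := sq_nonneg K
  have t1 : mean p (fun _ u v : Word n =>
      if n * D₀ ≤ (hammingNorm (qerr U u + qerr U v) : ℝ) then 1 else 0) ≤
      β + K * β + K ^ 2 * ρ₁ := by
    have h2 := sum_sum_qerr_le U C hU h0 h1 a
      (fun w => if n * D₀ ≤ (hammingNorm w : ℝ) then 1 else 0) (fun _ => g0 _ _)
      (fun _ => g1 _ _) hβ hK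
    rw [mean, ← Finset.sum_mul, sum_bernWord, one_mul]
    linarith [mul_le_mul_of_nonneg_left hρ₁ hK2]
  have t2 := mean_qerr_le hp0 hp1 U C hU h0 h1 a
      (fun w => if n * t ≤ (hammingNorm w : ℝ) then 1 else 0) (fun _ => g0 _ _)
      (fun _ => g1 _ _) hβ hK
  have t3 : ∑ c ∈ S.erase 0, mean p (fun z u v : Word n => if V.mulVec c = 0 then
        (if z + qerr U u + qerr U v + c ∈ ball n t then (1 : ℝ) else 0) else 0) ≤
      (1 / 2) ^ r * (Nat.card C * (ball n t).card / 2 ^ n) := by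
    have e1 : ∀ c, mean p (fun z u v : Word n => if V.mulVec c = 0 then
        (if z + qerr U u + qerr U v + c ∈ ball n t then (1 : ℝ) else 0) else 0) =
        if V.mulVec c = 0 then w c else 0 := by
      intro c
      split_ifs
      · rfl
      · exact mean_const p n 0
    simp only [e1]
    refine hV.trans (mul_le_mul_of_nonneg_left ?_ (by positivity))
    rw [← hScard, ← sum_mean_ball p U S hS]
    refine Finset.sum_le_sum_of_subset_of_nonneg (Finset.erase_subset _ _) fun c _ _ => ?_
    rw [← mean_const p n 0]
    exact mean_mono hp0 hp1 fun _ _ _ => by split_ifs <;> norm_num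
  linarith [mul_le_mul_of_nonneg_left hρ₂ hK2]

/-! ### Asymptotics of the dithered linear scheme -/

theorem le_bconv {p q : ℝ} (hp0 : 0 ≤ p) (hq : q ≤ 1 / 2) : q ≤ bconv p q := by
  unfold bconv; nlinarith

theorem bconv_le_half {p q : ℝ} (hp : p ≤ 1 / 2) (hq : q ≤ 1 / 2) : bconv p q ≤ 1 / 2 := by
  unfold bconv; nlinarith

theorem bconv_nonneg {p q : ℝ} (hp0 : 0 ≤ p) (hp : p ≤ 1 / 2) (hq0 : 0 ≤ q) (hq : q ≤ 1 / 2) :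
    0 ≤ bconv p q := by
  unfold bconv
  exact add_nonneg (mul_nonneg hp0 (by linarith)) (mul_nonneg (by linarith) hq0)

theorem tendsto_bound {x θ : ℝ} (hx0 : 0 ≤ x) (hx1 : x < 1) (hθ0 : 0 ≤ θ) (hθ1 : θ < 1) :
    Tendsto (fun n : ℕ => 2 * ((1 + 4 * (n : ℝ) + 16 * (n : ℝ) ^ 2) * x ^ n) +
      8 * ((n : ℝ) * θ ^ n)) atTop (𝓝 0) := by
  have a0 := tendsto_pow_atTop_nhds_zero_of_lt_one hx0 hx1
  have a1 := tendsto_self_mul_const_pow_of_lt_one hx0 hx1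
  have a2 := tendsto_pow_const_mul_const_pow_of_abs_lt_one 2 (abs_lt.2 ⟨by linarith, hx1⟩)
  have b1 := tendsto_self_mul_const_pow_of_lt_one hθ0 hθ1
  have := (((a0.add (a1.const_mul 4)).add (a2.const_mul 16)).const_mul 2).add (b1.const_mul 8)
  simp only [mul_zero, add_zero] at this
  refine this.congr fun n => ?_
  ring

theorem half_pow_floor_le (x : ℝ) : ((1 : ℝ) / 2) ^ ⌊x⌋₊ ≤ 2 * (2 : ℝ) ^ (-x) := by
  have h := (Nat.lt_floor_add_one x).le
  rw [one_div, inv_pow, ← Real.rpow_natCast, ← Real.rpow_neg (by norm_num)]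
  calc (2 : ℝ) ^ (-(⌊x⌋₊ : ℝ)) ≤ (2 : ℝ) ^ (1 + -x) :=
        Real.rpow_le_rpow_of_exponent_le (by norm_num) (by linarith)
    _ = 2 * (2 : ℝ) ^ (-x) := by rw [Real.rpow_add (by norm_num), Real.rpow_one]

theorem rpow_natCast_mul_eq (x : ℝ) (n : ℕ) : (2 : ℝ) ^ (n * x) = ((2 : ℝ) ^ x) ^ n := by
  rw [mul_comm, Real.rpow_mul (by norm_num), Real.rpow_natCast]

/-- As `γ` tends to 0 the first expression tends to `ρ` and the exponent to `Hb q`. The square is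
the price of two changes of measure. -/
theorem exists_radius_margin (q : ℝ) {ρ η : ℝ} (hρ : ρ < 1) (hη : 0 < η) :
    ∃ γ : ℝ, 0 < γ ∧ ((2 : ℝ) ^ (ell q (q + γ) - ell q (q - γ))) ^ 2 * ρ < 1 ∧
      Hb q - η < ell q (q - γ) := by
  have c1 : Continuous fun γ : ℝ => ell q (q + γ) :=
    (continuous_ell q).comp (continuous_const.add continuous_id)
  have c2 : Continuous fun γ : ℝ => ell q (q - γ) :=
    (continuous_ell q).comp (continuous_const.sub continuous_id)
  have c3 : Continuous fun γ : ℝ => ((2 : ℝ) ^ (ell q (q + γ) - ell q (q - γ))) ^ 2 * ρ :=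
    ((continuous_const.rpow (c1.sub c2) fun _ => Or.inl (by norm_num)).pow 2).mul
      continuous_const
  have e1 : ∀ᶠ γ in 𝓝 (0 : ℝ), ((2 : ℝ) ^ (ell q (q + γ) - ell q (q - γ))) ^ 2 * ρ < 1 :=
    c3.continuousAt.eventually (gt_mem_nhds (by simpa using hρ))
  have e2 : ∀ᶠ γ in 𝓝 (0 : ℝ), Hb q - η < ell q (q - γ) :=
    c2.continuousAt.eventually (lt_mem_nhds (by simp [ell_self, hη]))
  obtain ⟨γ, ⟨h1, h2⟩, h3⟩ := (((e1.and e2).filter_mono nhdsWithin_le_nhds).and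
    (self_mem_nhdsWithin (s := Set.Ioi (0 : ℝ)))).exists
  exact ⟨γ, h3, h1, h2⟩

theorem competitors_bound {n : ℕ} {R c N B x y : ℝ} (hN0 : 0 ≤ N) (hB0 : 0 ≤ B)
    (hN : N ≤ 2 ^ n * (c * n) * (2 : ℝ) ^ (-(n * x))) (hB : B ≤ (2 : ℝ) ^ (n * y)) :
    ((1 : ℝ) / 2) ^ ⌊n * R⌋₊ * (N * B / 2 ^ n) ≤ 2 * c * (n * ((2 : ℝ) ^ (y - x - R)) ^ n) := by
  have h2n : (0 : ℝ) < 2 ^ n := by positivity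
  have h1 : N * B / 2 ^ n ≤ c * n * (2 : ℝ) ^ (-(n * x)) * (2 : ℝ) ^ (n * y) := by
    rw [div_le_iff₀ h2n]
    refine (mul_le_mul hN hB hB0 (hN0.trans hN)).trans_eq ?_
    ring
  refine (mul_le_mul (half_pow_floor_le (n * R)) h1 (by positivity) (by positivity)).trans_eq ?_
  have h2 : ((2 : ℝ) ^ (y - x - R)) ^ n =
      (2 : ℝ) ^ (-(n * R)) * (2 : ℝ) ^ (-(n * x)) * (2 : ℝ) ^ (n * y) := by
    rw [← rpow_natCast_mul_eq, ← Real.rpow_add (by norm_num), ← Real.rpow_add (by norm_num)]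
    congr 1
    ring
  rw [h2]
  ring

/-- Here `4 * n * κ ^ n` is the change-of-measure factor and the first `ρ ^ n` bounds the uncovered
fraction; `κ ≥ 1` lets the term with `κ ^ 2` dominate up to a polynomial. -/
theorem quantization_bound {κ ρ : ℝ} (hκ : 1 ≤ κ) (hρ : 0 < ρ) (n : ℕ) :
    ρ ^ n + 4 * n * κ ^ n * ρ ^ n + (4 * n * κ ^ n) ^ 2 * ρ ^ n ≤
      (1 + 4 * n + 16 * (n : ℝ) ^ 2) * (κ ^ 2 * ρ) ^ n := by
  have h1 : (1 : ℝ) ≤ κ ^ n := one_le_pow₀ hκ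
  have h2 : (κ ^ 2 * ρ) ^ n = κ ^ n * κ ^ n * ρ ^ n := by rw [mul_pow, ← pow_mul]; ring
  rw [h2]
  have h3 : κ ^ n ≤ κ ^ n * κ ^ n := le_mul_of_one_le_left (by positivity) h1
  have hρn : 0 < ρ ^ n := by positivity
  have h4 := mul_le_mul_of_nonneg_right (h1.trans h3) hρn.le
  have h5 := mul_le_mul_of_nonneg_left (mul_le_mul_of_nonneg_right h3 hρn.le)
    (by positivity : (0 : ℝ) ≤ 4 * n)
  linarith

theorem eventually_exists_linear_scheme {p q R D : ℝ} (hp0 : 0 ≤ p) (hp : p ≤ 1 / 2) (hq0 : 0 < q)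
    (hq : q ≤ 1 / 2) (hR : Hb (bconv (bconv p q) q) - Hb q < R) (hD : bconv q q < D) :
    ∀ᶠ n : ℕ in atTop, ∃ (U : Matrix (Fin n) (Fin n) (ZMod 2))
      (V : Matrix (Fin ⌊n * R⌋₊) (Fin n) (ZMod 2)),
      (∑ dX : Word n, ∑ dY : Word n,
        (1 / 2 ^ n : ℝ) * (1 / 2 ^ n : ℝ) * ditheredDistortion p U V dX dY) ≤ D := by
  set s := bconv (bconv p q) q with hs
  have hpq := bconv_le_half hp hq
  have hpq0 := bconv_nonneg hp0 hp hq0.le hq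
  have hs0 : 0 < s := hq0.trans_le (le_bconv hpq0 hq)
  have hs1 : s ≤ 1 / 2 := bconv_le_half hpq hq
  have hqq0 := bconv_nonneg hq0.le hq hq0.le hq
  have hqq1 := bconv_le_half hq hq
  obtain ⟨D₀, hD₀, hD₀D⟩ := exists_between hD
  obtain ⟨ρ₁, hρ₁0, hρ₁1, hρ₁⟩ := exists_bernWord_tail_le hqq0 (by linarith) hD₀
  -- One `η` pays for the decoding radius `t > s`, the other for the covering radius; together they
  -- give `θ < 1` below.
  obtain ⟨η, hη0, hη⟩ : ∃ η : ℝ, 0 < η ∧ Hb s - Hb q + 2 * η < R :=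
    ⟨(R - (Hb s - Hb q)) / 3, by linarith, by linarith⟩
  obtain ⟨t, ht1, ht⟩ : ∃ t, ell s t < Hb s + η ∧ s < t := by
    have h1 : Tendsto (ell s) (𝓝[>] s) (𝓝 (Hb s)) := by
      rw [← ell_self]
      exact (continuous_ell s).continuousAt.tendsto.mono_left nhdsWithin_le_nhds
    exact ((h1.eventually (gt_mem_nhds (by linarith : Hb s < Hb s + η))).and
      self_mem_nhdsWithin).exists
  obtain ⟨ρ₂, hρ₂0, hρ₂1, hρ₂⟩ := exists_bernWord_tail_le hs0.le (by linarith) ht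
  -- A common rate of decay for both weight events and for the uncovered fraction `exp (-n)`.
  set ρ := max (max ρ₁ ρ₂) (Real.exp (-1)) with hρ
  have hρ1 : ρ < 1 := max_lt (max_lt hρ₁1 hρ₂1) (by simp)
  have hρ0 : 0 < ρ := (Real.exp_pos _).trans_le (le_max_right _ _)
  obtain ⟨γ, hγ0, hγ1, hγ2⟩ := exists_radius_margin q hρ1 hη0
  set κ := (2 : ℝ) ^ (ell q (q + γ) - ell q (q - γ)) with hκ
  have hκ1 : 1 ≤ κ := by
    apply Real.one_le_rpow (by norm_num)
    rw [ell_sub]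
    exact mul_nonneg (by linarith) (sub_nonneg.2 (logb_le_logb_one_sub hq0 hq))
  set θ := (2 : ℝ) ^ (ell s t - ell q (q - γ) - R) with hθ
  have hθ1 : θ < 1 := Real.rpow_lt_one_of_one_lt_of_neg (by norm_num) (by linarith)
  have hθ0 : 0 ≤ θ := by positivity
  have hx0 : 0 ≤ κ ^ 2 * ρ := by positivity
  filter_upwards [le_card_ball hq0 hq (by linarith : q < q + γ) (by linarith : q - γ < q),
    (tendsto_bound hx0 hγ1 hθ0 hθ1).eventually (gt_mem_nhds (sub_pos.2 hD₀D)),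
    eventually_ge_atTop 1] with n hT hlim hn
  have hn1 : (1 : ℝ) ≤ n := by exact_mod_cast hn
  have h2n : (0 : ℝ) < 2 ^ n := by positivity
  have hT0 : (0 : ℝ) < (ball n (q + γ)).card := lt_of_lt_of_le (by positivity) hT
  obtain ⟨C, hC, hunc⟩ := exists_covering_code hn (ball n (q + γ))
    (Finset.card_pos.1 (by exact_mod_cast hT0))
  obtain ⟨U, hU⟩ := exists_parityCheck C
  have hC' : (Nat.card C : ℝ) ≤ 2 ^ n * (4 * n) * (2 : ℝ) ^ (-(n * ell q (q - γ))) := by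
    have h1 := (mul_le_mul_of_nonneg_left hT (Nat.cast_nonneg (Nat.card C))).trans hC
    rw [Real.rpow_neg (by norm_num), ← div_eq_mul_inv, le_div_iff₀ (by positivity)]
    have h2 : (2 : ℝ) * (Nat.card C * (1 / 2 * 2 ^ (n * ell q (q - γ)))) ≤ 2 * (2 * n * 2 ^ n) :=
      mul_le_mul_of_nonneg_left h1 zero_le_two
    calc (Nat.card C : ℝ) * 2 ^ (n * ell q (q - γ))
        = 2 * (Nat.card C * (1 / 2 * 2 ^ (n * ell q (q - γ)))) := by ring
      _ ≤ 2 * (2 * n * 2 ^ n) := h2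
      _ = 2 ^ n * (4 * n) := by ring
  have hK : (Nat.card C : ℝ) * (2 : ℝ) ^ (n * ell q (q + γ)) ≤ 2 ^ n * (4 * n * κ ^ n) := by
    refine (mul_le_mul_of_nonneg_right hC' (by positivity)).trans_eq ?_
    rw [hκ, ← rpow_natCast_mul_eq, mul_sub, sub_eq_add_neg (n * ell q (q + γ)),
      Real.rpow_add (by norm_num)]
    ring
  have hexp : Real.exp (-n) ≤ ρ ^ n := by
    have : Real.exp (-n) = Real.exp (-1) ^ n := by
      rw [← Real.exp_nat_mul]; congr 1; ring
    rw [this]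
    exact pow_le_pow_left₀ (Real.exp_pos _).le (le_max_right _ _) n
  have hβ : ((uncovered (ball n (q + γ)) C).card : ℝ) ≤ 2 ^ n * ρ ^ n :=
    hunc.trans (mul_le_mul_of_nonneg_left hexp h2n.le)
  obtain ⟨V, hV⟩ := exists_average_ditheredDistortion_le hp0 (by linarith : p ≤ 1) hn U C hU hq0 hq
    (q + γ) t (hqq0.trans hD₀.le) ⌊n * R⌋₊ hβ hK
    ((hρ₁ n).trans (pow_le_pow_left₀ hρ₁0.le ((le_max_left _ _).trans (le_max_left _ _)) n))
    ((hρ₂ n).trans (pow_le_pow_left₀ hρ₂0.le ((le_max_right _ _).trans (le_max_left _ _)) n))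
  refine ⟨U, V, hV.trans ?_⟩
  have hB := card_ball_le hs0 hs1 n t
  have hthird := competitors_bound (R := R) (Nat.cast_nonneg _) (Nat.cast_nonneg _) hC' hB
  rw [← hθ] at hthird
  linarith [quantization_bound hκ1 hρ0 n]

/-! ### From averages over the dither to schemes -/

theorem two_pow_le_numMessages {n r : ℕ} {R : ℝ} (h : (r : ℝ) ≤ n * R) :
    2 ^ r ≤ numMessages n R := by
  unfold numMessages
  apply Nat.le_floor
  push_cast
  rw [← Real.rpow_natCast]
  exact Real.rpow_le_rpow_of_exponent_le (by norm_num) h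

theorem exists_dither_le {n : ℕ} {F : Word n → Word n → ℝ} {D : ℝ}
    (h : (∑ dX : Word n, ∑ dY : Word n, (1 / 2 ^ n : ℝ) * (1 / 2 ^ n : ℝ) * F dX dY) ≤ D) :
    ∃ dX dY : Word n, F dX dY ≤ D := by
  by_contra! hc
  have h1 : (∑ _dX : Word n, ∑ _dY : Word n, (1 / 2 ^ n : ℝ) * (1 / 2 ^ n : ℝ) * D) <
      ∑ dX : Word n, ∑ dY : Word n, (1 / 2 ^ n : ℝ) * (1 / 2 ^ n : ℝ) * F dX dY :=
    Finset.sum_lt_sum_of_nonempty Finset.univ_nonempty fun x _ =>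
      Finset.sum_lt_sum_of_nonempty Finset.univ_nonempty fun y _ =>
        mul_lt_mul_of_pos_left (hc x y) (by positivity)
  simp only [Finset.sum_const, Finset.card_univ, card_word, nsmul_eq_mul] at h1
  push_cast at h1
  have h2 : (2 : ℝ) ^ n * (2 ^ n * (1 / 2 ^ n * (1 / 2 ^ n) * D)) = D := by field_simp
  linarith

/-! ### Continuity and monotonicity of the rate and distortion functions. -/

theorem Hb_eq (x : ℝ) : Hb x = Real.binEntropy x / Real.log 2 := by
  rw [Hb, Real.binEntropy_eq_negMulLog_add_negMulLog_one_sub]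
  simp only [Real.negMulLog, Real.logb]
  ring

theorem continuous_Hb : Continuous Hb := by
  have : Hb = fun x => Real.binEntropy x / Real.log 2 := funext Hb_eq
  rw [this]
  exact Real.binEntropy_continuous.div_const _

theorem Hb_le_Hb {x y : ℝ} (hx : 0 ≤ x) (hxy : x ≤ y) (hy : y ≤ 1 / 2) : Hb x ≤ Hb y := by
  rw [Hb_eq, Hb_eq]
  refine div_le_div_of_nonneg_right ?_ (Real.log_pos (by norm_num)).le
  refine Real.binEntropy_strictMonoOn.monotoneOn ⟨hx, ?_⟩ ⟨hx.trans hxy, ?_⟩ hxy <;>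
    norm_num at * <;> linarith

theorem rate_nonneg {p q : ℝ} (hp0 : 0 ≤ p) (hp : p ≤ 1 / 2) (hq0 : 0 ≤ q) (hq : q ≤ 1 / 2) :
    0 ≤ Hb (bconv (bconv p q) q) - Hb q :=
  sub_nonneg.2 (Hb_le_Hb hq0 (le_bconv (bconv_nonneg hp0 hp hq0 hq) hq)
    (bconv_le_half (bconv_le_half hp hq) hq))

theorem continuous_bconv_self : Continuous fun q : ℝ => bconv q q := by
  unfold bconv; fun_prop

theorem continuous_rate (p : ℝ) :
    Continuous fun q : ℝ => Hb (bconv (bconv p q) q) - Hb q := by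
  have : Continuous fun q : ℝ => bconv (bconv p q) q := by unfold bconv; fun_prop
  exact (continuous_Hb.comp this).sub continuous_Hb

/-- The test channel can be perturbed so that it meets a positive distortion strictly. -/
theorem exists_perturbed_parameter {p q R D : ℝ} (hq0 : 0 ≤ q) (hq : q ≤ 1 / 2)
    (hR : Hb (bconv (bconv p q) q) - Hb q < R) (hD : bconv q q ≤ D) (hD0 : 0 < D) :
    ∃ q' : ℝ, 0 < q' ∧ q' ≤ 1 / 2 ∧ Hb (bconv (bconv p q') q') - Hb q' < R ∧ bconv q' q' < D := by
  have e1 := (continuous_rate p).continuousAt.eventually (gt_mem_nhds hR)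
  -- At `q = 0` the positive `D` leaves room to increase `q`, which must be positive for the
  -- exponents. At `q > 0` a decrease of `q` makes `q * q` strictly smaller.
  rcases hq0.eq_or_lt with h | h
  · subst h
    have e2 := continuous_bconv_self.continuousAt.eventually
      (gt_mem_nhds (show bconv 0 0 < D by simpa [bconv] using hD0))
    have e3 := gt_mem_nhds (show (0 : ℝ) < 1 / 2 by norm_num)
    obtain ⟨q', ⟨h1, h2, h3⟩, h4⟩ := (((e1.and (e2.and e3)).filter_mono nhdsWithin_le_nhds).and
      (self_mem_nhdsWithin (s := Set.Ioi (0 : ℝ)))).exists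
    exact ⟨q', h4, h3.le, h1, h2⟩
  · have e2 := lt_mem_nhds h
    obtain ⟨q', ⟨h1, h2⟩, h3⟩ := (((e1.and e2).filter_mono nhdsWithin_le_nhds).and
      (self_mem_nhdsWithin (s := Set.Iio q))).exists
    have h3 : q' < q := h3
    refine ⟨q', h2, by linarith, h1, lt_of_lt_of_le ?_ hD⟩
    unfold bconv
    nlinarith

theorem linearSchemeAchieves_of_pos {p R₁ R₂ D : ℝ} (hp0 : 0 ≤ p) (hp : p ≤ 1 / 2)
    (hT : (R₁, R₂, D) ∈ regionC p) (hD : 0 < D) : LinearSchemeAchieves p R₁ R₂ D := by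
  obtain ⟨q, hq0, hq, h1, h2, h3⟩ := hT
  simp only at h1 h2 h3
  intro ε hε
  obtain ⟨q', hq'0, hq', hR, hD'⟩ := exists_perturbed_parameter hq0 hq
    (show Hb (bconv (bconv p q) q) - Hb q < min R₁ R₂ + ε by
      linarith [le_min h1 h2]) h3 hD
  have hpos : 0 ≤ min R₁ R₂ + ε := (rate_nonneg hp0 hp hq'0.le hq').trans hR.le
  obtain ⟨n₀, hn₀⟩ := eventually_atTop.1
    (eventually_exists_linear_scheme hp0 hp hq'0 hq' hR hD')
  refine ⟨n₀, fun n hn => ?_⟩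
  obtain ⟨U, V, hUV⟩ := hn₀ n hn
  -- Both encoders send `r` bits, so the smaller rate decides.
  have hr : (⌊n * (min R₁ R₂ + ε)⌋₊ : ℝ) ≤ n * (min R₁ R₂ + ε) :=
    Nat.floor_le (mul_nonneg (Nat.cast_nonneg n) hpos)
  have hn0 : (0 : ℝ) ≤ n := Nat.cast_nonneg n
  refine ⟨n, _, U, V, two_pow_le_numMessages (hr.trans ?_), two_pow_le_numMessages (hr.trans ?_),
    hUV, exists_dither_le hUV⟩
  · exact mul_le_mul_of_nonneg_left (by linarith [min_le_left R₁ R₂]) hn0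
  · exact mul_le_mul_of_nonneg_left (by linarith [min_le_right R₁ R₂]) hn0

/-! ### Coding schemes -/

theorem nonempty_lkmScheme {p D : ℝ} {n N₁ N₂ : ℕ} {M₁ M₂ : Type} [Fintype M₁] [Fintype M₂]
    (enc₁ : Word n → M₁) (enc₂ : Word n → M₂) (dec : M₁ → M₂ → Word n)
    (h₁ : Fintype.card M₁ ≤ N₁) (h₂ : Fintype.card M₂ ≤ N₂)
    (hD : lkmDistortion p enc₁ enc₂ dec ≤ D) : Nonempty (LKMScheme p n N₁ N₂ D) := by
  have : Nonempty M₁ := ⟨enc₁ 0⟩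
  have : Nonempty M₂ := ⟨enc₂ 0⟩
  obtain ⟨f₁⟩ := Function.Embedding.nonempty_of_card_le (h₁.trans_eq (Fintype.card_fin N₁).symm)
  obtain ⟨f₂⟩ := Function.Embedding.nonempty_of_card_le (h₂.trans_eq (Fintype.card_fin N₂).symm)
  refine ⟨⟨fun x => f₁ (enc₁ x), fun y => f₂ (enc₂ y),
    fun a b => dec (Function.invFun f₁ a) (Function.invFun f₂ b), ?_⟩⟩
  simpa only [lkmDistortion, Function.leftInverse_invFun f₁.injective _,
    Function.leftInverse_invFun f₂.injective _] using hD

theorem LKMScheme.nonempty_mono {p D D' : ℝ} {n N₁ N₂ N₁' N₂' : ℕ} (s : LKMScheme p n N₁ N₂ D)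
    (h₁ : N₁ ≤ N₁') (h₂ : N₂ ≤ N₂') (hD : D ≤ D') : Nonempty (LKMScheme p n N₁' N₂' D') :=
  nonempty_lkmScheme s.enc₁ s.enc₂ s.dec (by simpa using h₁) (by simpa using h₂)
    (s.distortion_le.trans hD)

theorem LinearSchemeAchieves.mem_regionLKM {p R₁ R₂ D : ℝ}
    (h : LinearSchemeAchieves p R₁ R₂ D) : (R₁, R₂, D) ∈ regionLKM p := by
  intro ε hε
  obtain ⟨n₀, hn₀⟩ := h ε hε
  refine ⟨n₀, fun n hn => ?_⟩
  obtain ⟨m, r, U, V, h1, h2, -, dX, dY, hd⟩ := hn₀ n hn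
  exact nonempty_lkmScheme _ _ _ ((card_word r).trans_le h1) ((card_word r).trans_le h2) hd

/-- Each user knows its own source, hence its own message, and can run the common decoder. Both
obtain the same word, so they never disagree. -/
theorem regionLKM_subset_regionCSR (p : ℝ) : regionLKM p ⊆ regionCSR p := by
  intro T hT ε hε
  obtain ⟨n₀, hn₀⟩ := hT ε hε
  refine ⟨n₀, fun n hn => ?_⟩
  obtain ⟨s⟩ := hn₀ n hn
  exact ⟨⟨s.enc₁, s.enc₂, fun x b => s.dec (s.enc₁ x) b, fun y a => s.dec a (s.enc₂ y),
    s.distortion_le, s.distortion_le, by simp [prob, expect, hε.le]⟩⟩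

/-! ### Lossless and trivial schemes -/

theorem distortion_self {n : ℕ} (z : Word n) : distortion z z = 0 := by
  simp [distortion]

theorem bernWord_zero_of_ne {n : ℕ} {z : Word n} (hz : z ≠ 0) : bernWord 0 z = 0 := by
  obtain ⟨i, hi⟩ := Function.ne_iff.1 hz
  exact Finset.prod_eq_zero (Finset.mem_univ i) (by simpa [bern] using hi)

/-- Without parity checks every word is its own quantization and the errors vanish. -/
theorem ditheredDistortion_of_no_rows (p : ℝ) {r n : ℕ} (U : Matrix (Fin 0) (Fin n) (ZMod 2))
    (V : Matrix (Fin r) (Fin n) (ZMod 2)) (dX dY : Word n) :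
    ditheredDistortion p U V dX dY = ∑ z, bernWord p z * distortion z (recon U V z) := by
  have hq : ∀ u, qerr U u = 0 := by
    intro u
    have := hammingNorm_add_quantize_le U u (z := u) (Subsingleton.elim _ _)
    rw [word_add_self, hammingNorm_zero, Nat.le_zero, hammingNorm_eq_zero] at this
    exact this
  rw [ditheredDistortion_eq, ← expect_add p fun z => distortion z (recon U V z)]
  simp only [hq, add_zero]

/-- For `p = 0` the sum is almost surely zero and nothing is sent. For rates at least 1, `V` is the
identity and the syndrome reveals the whole sum. -/
theorem linearSchemeAchieves_zero {p R₁ R₂ : ℝ} (h₁ : 0 ≤ R₁) (h₂ : 0 ≤ R₂)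
    (h : p = 0 ∨ 1 ≤ min R₁ R₂) : LinearSchemeAchieves p R₁ R₂ 0 := by
  intro ε hε
  refine ⟨0, fun n _ => ?_⟩
  have hn : (0 : ℝ) ≤ n := Nat.cast_nonneg n
  rcases h with rfl | h
  · have hd : ∀ dX dY : Word n, ditheredDistortion 0 (0 : Matrix (Fin 0) (Fin n) (ZMod 2))
        (0 : Matrix (Fin 0) (Fin n) (ZMod 2)) dX dY = 0 := by
      intro dX dY
      rw [ditheredDistortion_of_no_rows]
      refine Finset.sum_eq_zero fun z _ => ?_
      by_cases hz : z = 0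
      · have := (recon_spec (0 : Matrix (Fin 0) (Fin n) (ZMod 2))
          (0 : Matrix (Fin 0) (Fin n) (ZMod 2)) z).2.2
        rw [hz, hammingNorm_zero, Nat.le_zero, hammingNorm_eq_zero] at this
        rw [hz, this, distortion_self, mul_zero]
      · rw [bernWord_zero_of_ne hz, zero_mul]
    refine ⟨0, 0, 0, 0, two_pow_le_numMessages ?_, two_pow_le_numMessages ?_, ?_, 0, 0,
      (hd 0 0).le⟩
    · simpa using mul_nonneg hn (by linarith : 0 ≤ R₁ + ε)
    · simpa using mul_nonneg hn (by linarith : 0 ≤ R₂ + ε)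
    · simp [hd]
  · have hd : ∀ dX dY : Word n, ditheredDistortion p (0 : Matrix (Fin 0) (Fin n) (ZMod 2))
        (1 : Matrix (Fin n) (Fin n) (ZMod 2)) dX dY = 0 := by
      intro dX dY
      rw [ditheredDistortion_of_no_rows]
      refine Finset.sum_eq_zero fun z _ => ?_
      have := (recon_spec (0 : Matrix (Fin 0) (Fin n) (ZMod 2))
        (1 : Matrix (Fin n) (Fin n) (ZMod 2)) z).2.1
      rw [Matrix.one_mulVec, Matrix.one_mulVec] at this
      rw [this, distortion_self, mul_zero]
    refine ⟨0, n, 0, 1, two_pow_le_numMessages ?_, two_pow_le_numMessages ?_, ?_, 0, 0,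
      (hd 0 0).le⟩
    · exact le_mul_of_one_le_right hn (by linarith [min_le_left R₁ R₂])
    · exact le_mul_of_one_le_right hn (by linarith [min_le_right R₁ R₂])
    · simp [hd]

theorem nonneg_of_mem_regionC {p R₁ R₂ D : ℝ} (hp0 : 0 ≤ p) (hp : p ≤ 1 / 2)
    (hT : (R₁, R₂, D) ∈ regionC p) : 0 ≤ R₁ ∧ 0 ≤ R₂ ∧ 0 ≤ D := by
  obtain ⟨q, hq0, hq, h1, h2, h3⟩ := hT
  have := rate_nonneg hp0 hp hq0 hq
  exact ⟨this.trans h1, this.trans h2, (bconv_nonneg hq0 hq hq0 hq).trans h3⟩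

theorem linearSchemeAchieves_of_mem_regionC {p R₁ R₂ D : ℝ} (hp0 : 0 ≤ p) (hp : p ≤ 1 / 2)
    (hT : (R₁, R₂, D) ∈ regionC p) (hex : ¬(D = 0 ∧ 0 < p ∧ min R₁ R₂ < 1)) :
    LinearSchemeAchieves p R₁ R₂ D := by
  obtain ⟨h1, h2, h3⟩ := nonneg_of_mem_regionC hp0 hp hT
  rcases h3.eq_or_lt with rfl | h
  · refine linearSchemeAchieves_zero h1 h2 ?_
    by_contra! hc
    exact hex ⟨rfl, lt_of_le_of_ne hp0 (Ne.symm hc.1), hc.2⟩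
  · exact linearSchemeAchieves_of_pos hp0 hp hT h

theorem mem_regionC_mono {p R₁ R₂ D D' : ℝ} (hT : (R₁, R₂, D) ∈ regionC p) (hD : D ≤ D') :
    (R₁, R₂, D') ∈ regionC p := by
  obtain ⟨q, hq0, hq, h1, h2, h3⟩ := hT
  exact ⟨q, hq0, hq, h1, h2, h3.trans hD⟩

/-! ### Time sharing -/

theorem sum_append {M : Type*} [AddCommMonoid M] (a b : ℕ) (F : Word (a + b) → M) :
    ∑ x, F x = ∑ x₁ : Word a, ∑ x₂ : Word b, F (Fin.append x₁ x₂) := by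
  rw [← Fintype.sum_prod_type']
  exact (Fintype.sum_equiv (Fin.appendEquiv a b) _ _ fun _ => rfl).symm

theorem dsbsLaw_append (p : ℝ) {a b : ℕ} (x₁ y₁ : Word a) (x₂ y₂ : Word b) :
    dsbsLaw p (Fin.append x₁ x₂) (Fin.append y₁ y₂) = dsbsLaw p x₁ y₁ * dsbsLaw p x₂ y₂ := by
  simp [dsbsLaw, Fin.prod_univ_add]

theorem hammingDist_append {a b : ℕ} (x₁ y₁ : Word a) (x₂ y₂ : Word b) :
    hammingDist (Fin.append x₁ x₂) (Fin.append y₁ y₂) = hammingDist x₁ y₁ + hammingDist x₂ y₂ := by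
  simp only [hammingDist, Finset.card_filter, Fin.sum_univ_add, Fin.append_left, Fin.append_right]

theorem append_add_append {a b : ℕ} (x₁ y₁ : Word a) (x₂ y₂ : Word b) :
    Fin.append x₁ x₂ + Fin.append y₁ y₂ = Fin.append (x₁ + y₁) (x₂ + y₂) := by
  funext i
  refine Fin.addCases (fun i => ?_) (fun i => ?_) i <;> simp

theorem expect_one (p : ℝ) (n : ℕ) : expect p (fun _ _ : Word n => 1) = 1 := by
  rw [expect_add p fun _ => 1]
  simp [sum_bernWord]

theorem expect_append (p : ℝ) {a b : ℕ} (G : Word a → Word a → ℝ) (H : Word b → Word b → ℝ)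
    (F : Word (a + b) → Word (a + b) → ℝ)
    (hF : ∀ x₁ y₁ x₂ y₂, F (Fin.append x₁ x₂) (Fin.append y₁ y₂) = G x₁ y₁ + H x₂ y₂) :
    expect p F = expect p G + expect p H := by
  have h1 : expect p F = ∑ x₁ : Word a, ∑ y₁ : Word a, ∑ x₂ : Word b, ∑ y₂ : Word b,
      dsbsLaw p x₁ y₁ * dsbsLaw p x₂ y₂ * (G x₁ y₁ + H x₂ y₂) := by
    simp only [expect, sum_append a b, dsbsLaw_append, hF]
    exact Finset.sum_congr rfl fun x₁ _ => Finset.sum_comm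
  have h2 : ∀ x₁ y₁, ∑ x₂ : Word b, ∑ y₂ : Word b,
      dsbsLaw p x₁ y₁ * dsbsLaw p x₂ y₂ * (G x₁ y₁ + H x₂ y₂) =
      dsbsLaw p x₁ y₁ * G x₁ y₁ + dsbsLaw p x₁ y₁ * 1 * expect p H := by
    intro x₁ y₁
    have h3 : dsbsLaw p x₁ y₁ * G x₁ y₁ =
        dsbsLaw p x₁ y₁ * G x₁ y₁ * expect p (fun _ _ : Word b => 1) := by
      rw [expect_one, mul_one]
    rw [h3]
    simp only [expect, mul_add, Finset.sum_add_distrib, Finset.mul_sum]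
    congr 1 <;> exact Finset.sum_congr rfl fun _ _ => Finset.sum_congr rfl fun _ _ => by ring
  have h4 : ∑ x₁ : Word a, ∑ y₁ : Word a, dsbsLaw p x₁ y₁ = 1 := by
    simpa only [expect, mul_one] using expect_one p a
  simp only [h1, h2, Finset.sum_add_distrib, ← Finset.sum_mul, mul_one, h4, one_mul]
  rfl

theorem expect_mul_left (p c : ℝ) {n : ℕ} (F : Word n → Word n → ℝ) :
    expect p (fun x y => c * F x y) = c * expect p F := by
  simp only [expect, Finset.mul_sum]
  exact Finset.sum_congr rfl fun _ _ => Finset.sum_congr rfl fun _ _ => by ring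

theorem nonempty_lkmScheme_append {p D D' : ℝ} {a b N₁ N₂ N₁' N₂' : ℕ} (hab : 0 < a + b)
    (s : LKMScheme p a N₁ N₂ D) (s' : LKMScheme p b N₁' N₂' D') :
    Nonempty (LKMScheme p (a + b) (N₁ * N₁') (N₂ * N₂') ((a * D + b * D') / (a + b))) := by
  let fst : Word (a + b) → Word a := fun x i => x (Fin.castAdd b i)
  let snd : Word (a + b) → Word b := fun x i => x (Fin.natAdd a i)
  have hfst : ∀ (x₁ : Word a) (x₂ : Word b), fst (Fin.append x₁ x₂) = x₁ := fun x₁ x₂ => by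
    funext i; simp [fst]
  have hsnd : ∀ (x₁ : Word a) (x₂ : Word b), snd (Fin.append x₁ x₂) = x₂ := fun x₁ x₂ => by
    funext i; simp [snd]
  have hab' : (0 : ℝ) < a + b := by exact_mod_cast hab
  refine nonempty_lkmScheme (M₁ := Fin N₁ × Fin N₁') (M₂ := Fin N₂ × Fin N₂')
    (fun x => (s.enc₁ (fst x), s'.enc₁ (snd x))) (fun y => (s.enc₂ (fst y), s'.enc₂ (snd y)))
    (fun u v => Fin.append (s.dec u.1 v.1) (s'.dec u.2 v.2)) (by simp) (by simp) ?_
  -- Unnormalized distortions add under concatenation; the identity also holds at length 0, so an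
  -- empty block is allowed.
  have hn : ∀ (n : ℕ) (z w : Word n), (n : ℝ) * distortion z w = hammingDist z w := by
    intro n z w
    rcases Nat.eq_zero_or_pos n with rfl | h
    · have : z = w := Subsingleton.elim _ _
      simp [this]
    · have : (n : ℝ) ≠ 0 := by exact_mod_cast h.ne'
      rw [distortion, mul_div_cancel₀ _ this]
  rw [le_div_iff₀ hab', mul_comm]
  have h1 := mul_le_mul_of_nonneg_left s.distortion_le (Nat.cast_nonneg (α := ℝ) a)
  have h2 := mul_le_mul_of_nonneg_left s'.distortion_le (Nat.cast_nonneg (α := ℝ) b)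
  refine le_trans (le_of_eq ?_) (add_le_add h1 h2)
  rw [← Nat.cast_add]
  simp only [lkmDistortion, ← expect_mul_left, hn]
  refine expect_append p _ _ _ fun x₁ y₁ x₂ y₂ => ?_
  simp only [hfst, hsnd, append_add_append, hammingDist_append]
  push_cast
  rfl

theorem numMessages_mono {n : ℕ} {R R' : ℝ} (h : R ≤ R') : numMessages n R ≤ numMessages n R' :=
  Nat.floor_le_floor (Real.rpow_le_rpow_of_exponent_le (by norm_num)
    (mul_le_mul_of_nonneg_left h (Nat.cast_nonneg n)))

theorem numMessages_mul_le {a b : ℕ} {R R' R'' : ℝ} (h : a * R + b * R' ≤ (a + b) * R'') :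
    numMessages a R * numMessages b R' ≤ numMessages (a + b) R'' := by
  unfold numMessages
  apply Nat.le_floor
  push_cast
  have h1 := Nat.floor_le (by positivity : (0 : ℝ) ≤ 2 ^ ((a : ℝ) * R))
  have h2 := Nat.floor_le (by positivity : (0 : ℝ) ≤ 2 ^ ((b : ℝ) * R'))
  refine (mul_le_mul h1 h2 (Nat.cast_nonneg _) (by positivity)).trans ?_
  rw [← Real.rpow_add (by norm_num)]
  exact Real.rpow_le_rpow_of_exponent_le (by norm_num) h

/-- The triples that lossy Körner–Marton schemes achieve when the distortion, too, may be exceeded by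
an arbitrarily small amount. -/
def slackRegion (p : ℝ) : Set (ℝ × ℝ × ℝ) :=
  {T | ∀ ε : ℝ, 0 < ε → ∃ n₀ : ℕ, ∀ n : ℕ, n₀ ≤ n →
    Nonempty (LKMScheme p n (numMessages n (T.1 + ε)) (numMessages n (T.2.1 + ε)) (T.2.2 + ε))}

/-- The two sides differ by `(a - α * (a + b)) * (R - R')` and half of the slack: rounding the block
lengths costs a bounded amount, which the slack absorbs in long blocks. -/
theorem split_le {a b ε α β R R' : ℝ} (hαβ : α + β = 1)
    (h1 : |a - α * (a + b)| ≤ 1) (h2 : |R - R'| ≤ (a + b) * (ε / 2)) :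
    a * (R + ε / 2) + b * (R' + ε / 2) ≤ (a + b) * (α * R + β * R' + ε) := by
  have h3 : (a - α * (a + b)) * (R - R') ≤ (a + b) * (ε / 2) := by
    refine (le_abs_self _).trans ?_
    rw [abs_mul]
    exact (mul_le_of_le_one_left (abs_nonneg _) h1).trans h2
  have hβ : β = 1 - α := by linarith
  subst hβ
  linarith

theorem exists_split {α β : ℝ} (hα : 0 < α) (hβ : 0 < β) (hαβ : α + β = 1) (k : ℕ) :
    ∀ᶠ n : ℕ in atTop, ∃ a b : ℕ, a + b = n ∧ k ≤ a ∧ k ≤ b ∧ |(a : ℝ) - α * n| ≤ 1 := by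
  have e1 := (tendsto_natCast_atTop_atTop (R := ℝ)).const_mul_atTop hα
  have e2 := (tendsto_natCast_atTop_atTop (R := ℝ)).const_mul_atTop hβ
  -- The extra 1 makes up for the floor in `⌊α * n⌋₊`.
  filter_upwards [e1.eventually_ge_atTop (k + 1), e2.eventually_ge_atTop k] with n h1 h2
  have hαn : (0 : ℝ) ≤ α * n := by positivity
  have f1 := Nat.floor_le hαn
  have f2 := (Nat.lt_floor_add_one (α * n)).le
  have hβ' : β = 1 - α := by linarith
  have hle : ⌊α * n⌋₊ ≤ n := by
    have : (⌊α * n⌋₊ : ℝ) ≤ n := by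
      subst hβ'
      nlinarith [Nat.cast_nonneg (α := ℝ) n]
    exact_mod_cast this
  refine ⟨⌊α * n⌋₊, n - ⌊α * n⌋₊, by omega, ?_, ?_, ?_⟩
  · have : (k : ℝ) ≤ ⌊α * n⌋₊ := by linarith
    exact_mod_cast this
  · have : (k : ℝ) ≤ (n - ⌊α * n⌋₊ : ℕ) := by
      rw [Nat.cast_sub hle]
      subst hβ'
      linarith
    exact_mod_cast this
  · rw [abs_le]
    constructor <;> linarith

/-- Time sharing. -/
theorem convex_slackRegion (p : ℝ) : Convex ℝ (slackRegion p) := by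
  rw [convex_iff_forall_pos]
  rintro ⟨R₁, R₂, D⟩ hT ⟨R₁', R₂', D'⟩ hT' α β hα hβ hαβ ε hε
  obtain ⟨n₀, hn₀⟩ := hT (ε / 2) (by linarith)
  obtain ⟨n₁, hn₁⟩ := hT' (ε / 2) (by linarith)
  have e := (tendsto_natCast_atTop_atTop (R := ℝ)).atTop_mul_const (by linarith : 0 < ε / 2)
  refine eventually_atTop.1 ?_
  filter_upwards [exists_split hα hβ hαβ (max n₀ n₁), eventually_gt_atTop 0,
    e.eventually_ge_atTop |R₁ - R₁'|, e.eventually_ge_atTop |R₂ - R₂'|,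
    e.eventually_ge_atTop |D - D'|] with n hsplit hn h1 h2 h3
  obtain ⟨a, b, rfl, ha, hb, hab⟩ := hsplit
  obtain ⟨s⟩ := hn₀ a ((le_max_left _ _).trans ha)
  obtain ⟨s'⟩ := hn₁ b ((le_max_right _ _).trans hb)
  obtain ⟨t⟩ := nonempty_lkmScheme_append hn s s'
  push_cast at hab h1 h2 h3
  have hpos : (0 : ℝ) < a + b := by exact_mod_cast hn
  refine t.nonempty_mono (numMessages_mul_le (split_le hαβ hab h1))
    (numMessages_mul_le (split_le hαβ hab h2)) ?_
  rw [div_le_iff₀ hpos, mul_comm _ ((a : ℝ) + b)]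
  exact split_le hαβ hab h3

/-! ### The inner bound with slack, and the removal of the slack. -/

theorem regionC_subset_slackRegion {p : ℝ} (hp0 : 0 ≤ p) (hp : p ≤ 1 / 2) :
    regionC p ⊆ slackRegion p := by
  rintro ⟨R₁, R₂, D⟩ hT ε hε
  have hD := (nonneg_of_mem_regionC hp0 hp hT).2.2
  exact (linearSchemeAchieves_of_pos hp0 hp (mem_regionC_mono hT (by linarith : D ≤ D + ε))
    (by linarith)).mem_regionLKM ε hε

theorem nonempty_constant_lkmScheme {p R₁ R₂ D : ℝ} {n : ℕ} (h₁ : 0 ≤ R₁) (h₂ : 0 ≤ R₂)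
    (hD : ∑ z : Word n, bernWord p z * distortion z 0 ≤ D) :
    Nonempty (LKMScheme p n (numMessages n R₁) (numMessages n R₂) D) := by
  have h : ∀ R : ℝ, 0 ≤ R → Fintype.card Unit ≤ numMessages n R := fun R hR =>
    two_pow_le_numMessages (r := 0) (by simpa using mul_nonneg (Nat.cast_nonneg n) hR)
  refine nonempty_lkmScheme (fun _ => ()) (fun _ => ()) (fun _ _ => 0) (h _ h₁) (h _ h₂) ?_
  rwa [lkmDistortion, expect_add p fun z => distortion z 0]

theorem nonempty_identity_lkmScheme {p R₁ R₂ D : ℝ} {n : ℕ} (h₁ : 1 ≤ R₁) (h₂ : 1 ≤ R₂)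
    (hD : 0 ≤ D) : Nonempty (LKMScheme p n (numMessages n R₁) (numMessages n R₂) D) := by
  have h : ∀ R : ℝ, 1 ≤ R → Fintype.card (Word n) ≤ numMessages n R := fun R hR =>
    (card_word n).trans_le
      (two_pow_le_numMessages (le_mul_of_one_le_right (Nat.cast_nonneg n) hR))
  refine nonempty_lkmScheme id id (fun x y => x + y) (h _ h₁) (h _ h₂) ?_
  simpa [lkmDistortion, expect, distortion_self] using hD

theorem regionB_subset_slackRegion {p : ℝ} (hp0 : 0 ≤ p) (hp : p ≤ 1 / 2) :
    regionB p ⊆ slackRegion p := by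
  rintro ⟨R₁, R₂, D⟩ ⟨h1, h2, h3⟩ ε hε
  simp only at h1 h2 h3
  -- The zero word is the output, so the distortion is the weight of the sum per letter; it exceeds
  -- `p + ε / 2` with exponentially small probability.
  obtain ⟨ρ, hρ0, hρ1, hρ⟩ := exists_bernWord_tail_le hp0 (by linarith)
    (by linarith : p < p + ε / 2)
  refine eventually_atTop.1 ?_
  filter_upwards [(tendsto_pow_atTop_nhds_zero_of_lt_one hρ0.le hρ1).eventually
    (gt_mem_nhds (by linarith : 0 < ε / 2)), eventually_gt_atTop 0] with n hn hn0
  have hn0 : (0 : ℝ) < n := by exact_mod_cast hn0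
  refine nonempty_constant_lkmScheme (by linarith) (by linarith) ?_
  have hle : ∀ z : Word n, bernWord p z * distortion z 0 ≤ bernWord p z * (p + ε / 2) +
      bernWord p z * (if n * (p + ε / 2) ≤ (hammingNorm z : ℝ) then 1 else 0) := by
    intro z
    rw [← mul_add]
    refine mul_le_mul_of_nonneg_left ?_ (bernWord_nonneg hp0 (by linarith) z)
    split_ifs with h
    · linarith [distortion_le_one z 0]
    · rw [distortion, hammingDist_zero_right, div_le_iff₀ hn0]
      linarith
  have := Finset.sum_le_sum fun z (_ : z ∈ Finset.univ) => hle z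
  rw [Finset.sum_add_distrib, ← Finset.sum_mul, sum_bernWord] at this
  linarith [hρ n]

theorem convexHull_subset_slackRegion {p : ℝ} (hp0 : 0 ≤ p) (hp : p ≤ 1 / 2) :
    convexHull ℝ (regionC p ∪ regionB p) ⊆ slackRegion p :=
  convexHull_min (Set.union_subset (regionC_subset_slackRegion hp0 hp)
    (regionB_subset_slackRegion hp0 hp)) (convex_slackRegion p)

theorem nonneg_of_mem_convexHull {p : ℝ} (hp0 : 0 ≤ p) (hp : p ≤ 1 / 2) {T : ℝ × ℝ × ℝ}
    (hT : T ∈ convexHull ℝ (regionC p ∪ regionB p)) : 0 ≤ T := by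
  have h : convexHull ℝ (regionC p ∪ regionB p) ⊆ Set.Ici 0 := by
    refine convexHull_min (Set.union_subset ?_ ?_) (convex_Ici 0)
    · rintro ⟨R₁, R₂, D⟩ h
      exact nonneg_of_mem_regionC hp0 hp h
    · rintro ⟨R₁, R₂, D⟩ ⟨h1, h2, h3⟩
      exact ⟨h1, h2, hp0.trans h3⟩
  exact h hT

theorem mem_slackRegion_one (p : ℝ) : ((1, 1, 0) : ℝ × ℝ × ℝ) ∈ slackRegion p := fun ε hε =>
  ⟨0, fun _ _ => nonempty_identity_lkmScheme (by simp [hε.le]) (by simp [hε.le])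
    (by simp [hε.le])⟩

/-- Sharing a little time with a lossless scheme makes up for the slack in a positive distortion. -/
theorem mem_regionLKM_of_mem_slackRegion {p R₁ R₂ D : ℝ} (hT : (R₁, R₂, D) ∈ slackRegion p)
    (h₁ : 0 ≤ R₁) (h₂ : 0 ≤ R₂) (hD : 0 < D) : (R₁, R₂, D) ∈ regionLKM p := by
  intro ε hε
  -- The fraction `t` of lossless time raises the rates by at most `t < ε / 2` and lowers the
  -- distortion by `t * D`, which is the slack allowed below.
  obtain ⟨t, ht0, ht1⟩ : ∃ t : ℝ, 0 < t ∧ t < min 1 (ε / 2) :=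
    exists_between (lt_min one_pos (by linarith))
  have ht1' := ht1.trans_le (min_le_left _ _)
  have ht2 := ht1.trans_le (min_le_right _ _)
  have hmix := convex_slackRegion p hT (mem_slackRegion_one p) (by linarith : 0 ≤ 1 - t) ht0.le
    (by ring)
  obtain ⟨n₀, hn₀⟩ := hmix (min (ε / 2) (t * D)) (lt_min (by linarith) (by positivity))
  have hm1 := min_le_left (ε / 2) (t * D)
  have hm2 := min_le_right (ε / 2) (t * D)
  refine ⟨n₀, fun n hn => ?_⟩
  obtain ⟨s⟩ := hn₀ n hn
  refine s.nonempty_mono (numMessages_mono ?_) (numMessages_mono ?_) ?_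
  · simp only [Prod.fst_add, Prod.smul_fst, smul_eq_mul]
    nlinarith
  · simp only [Prod.fst_add, Prod.snd_add, Prod.smul_fst, Prod.smul_snd, smul_eq_mul]
    nlinarith
  · simp only [Prod.snd_add, Prod.smul_snd, smul_eq_mul]
    linarith

/-- Even the Körner–Marton region contains these triples. At `D = 0` the hull is needed only for the
signs of the rates, because the lossless scheme applies. -/
theorem mem_regionLKM_of_mem_convexHull {p R₁ R₂ D : ℝ} (hp0 : 0 ≤ p) (hp : p ≤ 1 / 2)
    (hT : (R₁, R₂, D) ∈ convexHull ℝ (regionC p ∪ regionB p))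
    (hex : ¬(D = 0 ∧ 0 < p ∧ min R₁ R₂ < 1)) : (R₁, R₂, D) ∈ regionLKM p := by
  obtain ⟨h1, h2, h3⟩ := nonneg_of_mem_convexHull hp0 hp hT
  rcases (show 0 ≤ D from h3).eq_or_lt with rfl | h
  · refine (linearSchemeAchieves_zero h1 h2 ?_).mem_regionLKM
    by_contra! hc
    exact hex ⟨rfl, lt_of_le_of_ne hp0 (Ne.symm hc.1), hc.2⟩
  · exact mem_regionLKM_of_mem_slackRegion (convexHull_subset_slackRegion hp0 hp hT) h1 h2 h

theorem mem_regionLKM_of_mem_convexHull_zero {p R₁ R₂ : ℝ} (hp0 : 0 ≤ p) (hp : p ≤ 1 / 2)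
    (hT : (R₁, R₂, 0) ∈ convexHull ℝ (regionC p ∪ regionB p)) {δ : ℝ} (hδ : 0 < δ) :
    (R₁, R₂, δ) ∈ regionLKM p := by
  intro ε hε
  -- With target distortion 0 the slack itself is the distortion, so it is capped at `δ`.
  obtain ⟨n₀, hn₀⟩ := convexHull_subset_slackRegion hp0 hp hT (min ε δ) (lt_min hε hδ)
  refine ⟨n₀, fun n hn => ?_⟩
  obtain ⟨s⟩ := hn₀ n hn
  exact s.nonempty_mono (numMessages_mono (add_le_add_right (min_le_left _ _) _))
    (numMessages_mono (add_le_add_right (min_le_left _ _) _)) (by simp)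

end CSR

theorem proposition2 (p : ℝ) (hp0 : 0 ≤ p) (hp : p ≤ 1 / 2) :
    (∀ R₁ R₂ D : ℝ, (R₁, R₂, D) ∈ CSR.regionC p →
      ¬ (D = 0 ∧ 0 < p ∧ min R₁ R₂ < 1) →
        CSR.LinearSchemeAchieves p R₁ R₂ D ∧ (R₁, R₂, D) ∈ CSR.regionLKM p) ∧
    (∀ R₁ R₂ : ℝ, (R₁, R₂, 0) ∈ CSR.regionC p → ∀ δ : ℝ, 0 < δ →
        CSR.LinearSchemeAchieves p R₁ R₂ δ ∧ (R₁, R₂, δ) ∈ CSR.regionLKM p) ∧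
    (∀ R₁ R₂ D : ℝ, (R₁, R₂, D) ∈ convexHull ℝ (CSR.regionC p ∪ CSR.regionB p) →
      ¬ (D = 0 ∧ 0 < p ∧ min R₁ R₂ < 1) →
        (R₁, R₂, D) ∈ CSR.regionCSR p) ∧
    (∀ R₁ R₂ : ℝ, (R₁, R₂, 0) ∈ convexHull ℝ (CSR.regionC p ∪ CSR.regionB p) →
      ∀ δ : ℝ, 0 < δ → (R₁, R₂, δ) ∈ CSR.regionCSR p) := by
  refine ⟨fun R₁ R₂ D hT hex => ?_, fun R₁ R₂ hT δ hδ => ?_, fun R₁ R₂ D hT hex => ?_,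
    fun R₁ R₂ hT δ hδ => ?_⟩
  · have h := CSR.linearSchemeAchieves_of_mem_regionC hp0 hp hT hex
    exact ⟨h, h.mem_regionLKM⟩
  · have h := CSR.linearSchemeAchieves_of_pos hp0 hp (CSR.mem_regionC_mono hT hδ.le) hδ
    exact ⟨h, h.mem_regionLKM⟩
  · exact CSR.regionLKM_subset_regionCSR p (CSR.mem_regionLKM_of_mem_convexHull hp0 hp hT hex)
  · exact CSR.regionLKM_subset_regionCSR p
      (CSR.mem_regionLKM_of_mem_convexHull_zero hp0 hp hT hδ)
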